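/- Let $I=\{1,\dots,n\}$, let $a_J\ge 0$ ($J\subset I$) with $a_\emptyset=0$, $\sum_{J\subset I}a_J=1$, and let $\gamma_i>0$ ($i\in I$) with $\sum_{i}\gamma_i=1$. For $A\subset I$ put $\mathcal P_A=\{J\subset A: a_J>0\}$, $\mathcal P=\mathcal P_I$, $\alpha(A)=\sum_{J\in\mathcal P_A}a_J$, $\gamma(A)=\sum_{i\in A}\gamma_i$, and assume that every $i\in I$ belongs to some $J\in\mathcal P$. For $N\in\mathbb N$ let $\Sigma_N^i=\{1,\dots,\lfloor 2^{\gamma_iN}\rfloor\}$ (so $|\Sigma_N^i|=2^{\gamma_i N}$ whenever this is an integer), $\Sigma_{N,A}=\prod_{i\in A}\Sigma_N^i$, and for $\sigma\in\Sigma_{N,A}$, $J\subset A$ let $\sigma_J=(\sigma_i)_{i\in J}$. Let $X^J_{\tau}$ ($J\in\mathcal P$, $\tau\in\Sigma_{N,J}$) be independent centered Gaussian random variables with variance $a_JN$, and let $\mathbb P$ be the underlying probability. The hamiltonian is $X_\sigma=\sum_{J\in\mathcal P}X^J_{\sigma_J}$, $\sigma\in\Sigma_{N,I}$. *Chain.*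 For $B\subsetneq A$ let $\rho(B,A)=\sqrt{2\log 2\,\frac{\gamma(A)-\gamma(B)}{\alpha(A)-\alpha(B)}}$ (with value $+\infty$ if $\alpha(A)=\alpha(B)$) and $\hat\rho(B)=\min_{A\supsetneq B}\rho(B,A)$. Let $A_0=\emptyset$ and, as long as $A_{j-1}\ne I$, let $\beta_j=\hat\rho(A_{j-1})$ and let $A_j$ be the largest $A\supsetneq A_{j-1}$ with $\rho(A_{j-1},A)=\beta_j$ (the union of all such $A$). This gives a chain $\emptyset=A_0\subsetneq A_1\subsetneq\dots\subsetneq A_K=I$. *Irreducibility.* The hamiltonian is irreducible if - (c) for every $j=1,\dots,K$ and every $A\subsetneq A_j\setminus A_{j-1}$ with $\mathcal P_{A\cup A_{j-1}}\setminus\mathcal P_{A_{j-1}}\neq\emptyset$ there are $J\in\mathcal P_{A_j}\setminus\mathcal P_{A\cup A_{j-1}}$ and $J'\in\mathcal P_{A\cup A_{j-1}}\setminus\mathcal P_{A_{j-1}}$ with $(J\cap J')\setminus A_{j-1}\ne\emptyset$; and - (c$'$) for every $j=2,\dots,K$ there are $s\in A_{j-1}\setminus A_{j-2}$ and $J\in\mathcal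 P_{A_j}\setminus\mathcal P_{A_{j-1}}$ with $s\in J$. *Partial energies.* For $j=1,\dots,K$ put $\Delta_j=\alpha(A_j)-\alpha(A_{j-1})$ and $$a_{N,j}=\beta_j\Delta_jN-\frac1{2\beta_j}\log N+\frac1{\beta_j}\log\!\big(\beta_j\sqrt{2\pi\Delta_j}\big),$$ and for $\sigma\in\Sigma_{N,A_j}$ put $$\widehat X_{\sigma(1),\dots,\sigma(j)}=\sum_{l=1}^j\Big(\sum_{J\in\mathcal P_{A_l}\setminus\mathcal P_{A_{l-1}}}X^J_{\sigma_J}-a_{N,l}\Big).$$ *Non-ultrametric couples.* $\sigma,\tau\in\Sigma_{N,A_j}$ form a non-ultrametric couple if for some $k\in\{1,\dots,j\}$ there is $s\in A_k\setminus A_{k-1}$ with $\sigma_s=\tau_s$, while $\sigma_r\ne\tau_r$ for some $r\in A_k$. **Proposition.** Assume that the hamiltonian is irreducible. Let $1\le j\le K$, let $\Diamond\subset\mathbb R$ be compact and let $\varepsilon>0$. Then there is $N_0$ such that for all $N\ge N_0$ $$\mathbb P\Big[\exists\text{ a non-ultrametric couple }\sigma,\tau\in\Sigma_{N,A_j}:\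 \widehat X_{\sigma(1),\dots,\sigma(j)}\in\Diamond\ \text{and}\ \widehat X_{\tau(1),\dots,\tau(j)}\in\Diamond\Big]\le\varepsilon .$$ -/

import Mathlib

open MeasureTheory ProbabilityTheory Filter

noncomputable section

/-- Parameters of the nonhierarchical GREM on the index set `I = Fin n`: the weights `a J ≥ 0` of
the subsets `J` of `I` and the proportions `γ i > 0`. -/
structure GREM (n : ℕ) where
  a : Finset (Fin n) → ℝ
  γ : Fin n → ℝ
  a_nonneg : ∀ J, 0 ≤ a J
  a_empty : a ∅ = 0
  a_sum : ∑ J, a J = 1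
  γ_pos : ∀ i, 0 < γ i
  γ_sum : ∑ i, γ i = 1

namespace GREM

variable {n : ℕ} (M : GREM n)

open Classical in
/-- `𝒫_A`, the subsets of `A` of positive weight. -/
def P (A : Finset (Fin n)) : Finset (Finset (Fin n)) :=
  A.powerset.filter (fun J => 0 < M.a J)

/-- `α(A)`. -/
def alpha (A : Finset (Fin n)) : ℝ := ∑ J ∈ M.P A, M.a J

/-- `γ(A)`. -/
def gam (A : Finset (Fin n)) : ℝ := ∑ i ∈ A, M.γ i

/-- `ρ(B, A)`, for `B ⊆ A` with `α(B) < α(A)`. -/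
def rho (B A : Finset (Fin n)) : ℝ :=
  √(2 * Real.log 2 * ((M.gam A - M.gam B) / (M.alpha A - M.alpha B)))

/-- The sets over which `ρ(B, ·)` is minimised: the strict supersets `A` of `B` for which `ρ(B, A)`
is finite. -/
def Admissible (B A : Finset (Fin n)) : Prop := B ⊂ A ∧ M.alpha B < M.alpha A

/-- `ρ̂(B)`, the minimum of `ρ(B, A)` over the strict supersets `A` of `B`. -/
def rhoHat (B : Finset (Fin n)) : ℝ := sInf {r | ∃ A, M.Admissible B A ∧ r = M.rho B A}

open Classical in
/-- The union of all minimisers of `ρ(B, ·)`, that is, the largest minimiser. -/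
def next (B : Finset (Fin n)) : Finset (Fin n) :=
  B ∪ (Finset.univ.filter (fun A => M.Admissible B A ∧ M.rho B A = M.rhoHat B)).sup id

/-- The chain `A_0 = ∅ ⊂ A_1 ⊂ ⋯ ⊂ A_K = I`; it is constant from `K` on. -/
def chain : ℕ → Finset (Fin n)
  | 0 => ∅
  | j + 1 => M.next (chain j)

/-- The length `K` of the chain, the first index at which it reaches `I`. -/
def K : ℕ := sInf {k | M.chain k = Finset.univ}

/-- The critical inverse temperatures `β_0 = 0`, `β_j = ρ̂(A_{j-1})`. -/
def beta : ℕ → ℝ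
  | 0 => 0
  | j + 1 => M.rhoHat (M.chain j)

/-- `𝒫_{A_j} \ 𝒫_{A_{j-1}}`, for `j ≥ 1`. -/
def level (j : ℕ) : Finset (Finset (Fin n)) := M.P (M.chain j) \ M.P (M.chain (j - 1))

/-- `Δ_j = α(A_j) - α(A_{j-1})`, for `j ≥ 1`. -/
def Delta (j : ℕ) : ℝ := M.alpha (M.chain j) - M.alpha (M.chain (j - 1))

/-- The centering `a_{N,j}`, for `j ≥ 1`. -/
def aN (N j : ℕ) : ℝ :=
  M.beta j * M.Delta j * N - 1 / (2 * M.beta j) * Real.log N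
    + 1 / M.beta j * Real.log (M.beta j * √(2 * Real.pi * M.Delta j))

/-- The first irreducibility condition. It concerns the `A ⊊ A_j \ A_{j-1}` for which
`𝒫_{A ∪ A_{j-1}} \ 𝒫_{A_{j-1}}` is not empty. -/
def CondC : Prop :=
  ∀ j, 1 ≤ j → j ≤ M.K → ∀ A, A ⊂ M.chain j \ M.chain (j - 1) →
    (M.P (A ∪ M.chain (j - 1)) \ M.P (M.chain (j - 1))).Nonempty →
      ∃ J ∈ M.P (M.chain j) \ M.P (A ∪ M.chain (j - 1)),
        ∃ J' ∈ M.P (A ∪ M.chain (j - 1)) \ M.P (M.chain (j - 1)),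
          ((J ∩ J') \ M.chain (j - 1)).Nonempty

/-- The second irreducibility condition. -/
def CondC' : Prop :=
  ∀ j, 2 ≤ j → j ≤ M.K →
    ∃ s ∈ M.chain (j - 1) \ M.chain (j - 2), ∃ J ∈ M.level j, s ∈ J

/-- Irreducibility of the hamiltonian. -/
def Irreducible : Prop := M.CondC ∧ M.CondC'

/-- The number of elements of `Σ_N^i`; it is `2 ^ (γ_i N)` whenever this is an integer. -/
def size (N : ℕ) (i : Fin n) : ℕ := ⌊(2 : ℝ) ^ (M.γ i * N)⌋₊

/-- The configurations `Σ_{N,A}`. -/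
abbrev Conf (N : ℕ) (A : Finset (Fin n)) : Type := (i : A) → Fin (M.size N i)

lemma chain_mono : Monotone M.chain :=
  monotone_nat_of_le_succ fun _ => Finset.subset_union_left

lemma subset_of_mem_level {j : ℕ} {J : Finset (Fin n)} (h : J ∈ M.level j) : J ⊆ M.chain j := by
  simp only [level, P, Finset.mem_sdiff, Finset.mem_filter, Finset.mem_powerset] at h
  exact h.1.1

variable {Ω : Type*} {N : ℕ}

/-- At size `N`, the variables `X J τ`, for `J ∈ 𝒫` and `τ ∈ Σ_{N,J}`, are independent centered
gaussians of variance `a_J N`. -/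
structure IsDisorder [MeasurableSpace Ω] (Pr : Measure Ω)
    (X : (J : Finset (Fin n)) → M.Conf N J → Ω → ℝ) : Prop where
  hasLaw : ∀ J ∈ M.P Finset.univ, ∀ τ : M.Conf N J,
    HasLaw (X J τ) (gaussianReal 0 (M.a J * N).toNNReal) Pr
  indep : iIndepFun
    (fun p : (Σ J : {J // J ∈ M.P Finset.univ}, M.Conf N J.1) => X p.1.1 p.2) Pr

/-- `X_{σ(1),…,σ(l)}` for `σ ∈ Σ_{N,A_l}`. -/
def energy (X : (J : Finset (Fin n)) → M.Conf N J → Ω → ℝ) (l : ℕ) (σ : M.Conf N (M.chain l))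
    (ω : Ω) : ℝ :=
  ∑ J : {J // J ∈ M.level l},
    X J.1 (Finset.restrict₂ (π := fun i => Fin (M.size N i)) (M.subset_of_mem_level J.2) σ) ω

/-- The centered energy `X̄_{σ(1),…,σ(l)}`. -/
def energyBar (X : (J : Finset (Fin n)) → M.Conf N J → Ω → ℝ) (l : ℕ)
    (σ : M.Conf N (M.chain l)) (ω : Ω) : ℝ :=
  M.energy X l σ ω - M.aN N l

/-- The partial energy `X̂_{σ(1),…,σ(j)}`, the sum of the centered energies of the levels
`1, …, j`. -/
def energyHat (X : (J : Finset (Fin n)) → M.Conf N J → Ω → ℝ) (j : ℕ)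
    (σ : M.Conf N (M.chain j)) (ω : Ω) : ℝ :=
  ∑ l : {l // l ∈ Finset.Icc 1 j},
    M.energyBar X l.1
      (Finset.restrict₂ (π := fun i => Fin (M.size N i))
        (M.chain_mono (Finset.mem_Icc.mp l.2).2) σ) ω

/-- `σ, τ ∈ Σ_{N,A_j}` agree at some site of `A_k \ A_{k-1}` but differ at some site of `A_k`, for
some `1 ≤ k ≤ j`. -/
def Nonultrametric (j : ℕ) (σ τ : M.Conf N (M.chain j)) : Prop :=
  ∃ k, 1 ≤ k ∧ k ≤ j ∧
    (∃ s : M.chain j, s.1 ∈ M.chain k \ M.chain (k - 1) ∧ σ s = τ s) ∧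
    (∃ r : M.chain j, r.1 ∈ M.chain k ∧ σ r ≠ τ r)

end GREM

end

/-! The proof is a first moment argument over couples, after a localisation of every level.

Localisation (`exists_window`). The identity `beta_sq_mul_Delta` makes the probability of a bounded
window of level `l` of the order of the inverse number of choices of the sites in `A_l \ A_{l-1}`.
So expected numbers of configurations with prescribed partial sums are bounded uniformly in `N`, and
because the `β_l` increase strictly (`beta_lt`) these bounds are small when some partial sum is far
from 0. Hence, up to probability `ε / 2`, a configuration with total energy in the compact set has
every level energy in `[-C, C]`.

Reduction (`exists_overlap`). At the smallest level `k` at which a couple violates ultrametricity,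
the two configurations agree within `A_{k-1}` exactly on some `A_r` with `r < k`, and on `A_k`
exactly on a set `S` containing part of `A_k \ A_{k-1}` but not all of `A_k`. There are finitely
many triples `(k, r, S)`.

Counting. The number of couples times the weights of their windows is `cap (S \ A_{k-1})⁻¹`
(`IsOverlap.cap_weights`), exponentially small. This settles the case where no set of level `k` lies
in `S`. Otherwise the shared part of the level `k` energy correlates the two windows and may consume
the whole exponential gain. It is then truncated at `cut`: above the cut, counting the
configurations on `S` alone gives `O(1/√N)` (`measure_truncated_le`); below it, the two independent
unshared parts yield a couple bound that is also `O(1/√N)` (`measure_pairs_below_cut_le`). The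
unshared part is not empty by `IsOverlap.unshared_nonempty`: by minimality of `β_k` if `r = k - 1`,
and by the second irreducibility condition if `r < k - 1`.

All gaussian estimates rest on one domination: a centered gaussian law is at most a constant times
`exp (-b x) dx`, for every `b`. -/

noncomputable section

/-! ### The chain: largest minimisers and strict growth of the `β_j` -/

namespace GREM

variable {n : ℕ} (M : GREM n)

lemma mem_P {A J : Finset (Fin n)} : J ∈ M.P A ↔ J ⊆ A ∧ 0 < M.a J := by
  simp [P]

lemma P_mono {A B : Finset (Fin n)} (h : A ⊆ B) : M.P A ⊆ M.P B := fun J hJ => by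
  rw [mem_P] at *
  exact ⟨hJ.1.trans h, hJ.2⟩

lemma alpha_mono {A B : Finset (Fin n)} (h : A ⊆ B) : M.alpha A ≤ M.alpha B :=
  Finset.sum_le_sum_of_subset_of_nonneg (M.P_mono h) fun J _ _ => M.a_nonneg J

lemma alpha_sub {A B : Finset (Fin n)} (h : A ⊆ B) :
    M.alpha B - M.alpha A = ∑ J ∈ M.P B \ M.P A, M.a J := by
  rw [alpha, alpha, ← Finset.sum_sdiff (M.P_mono h)]
  ring

lemma gam_sub {A B : Finset (Fin n)} (h : A ⊆ B) :
    M.gam B - M.gam A = M.gam (B \ A) := by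
  rw [gam, gam, gam, ← Finset.sum_sdiff h]
  ring

lemma gam_pos {A : Finset (Fin n)} (h : A.Nonempty) : 0 < M.gam A :=
  Finset.sum_pos (fun i _ => M.γ_pos i) h

lemma gam_lt {A B : Finset (Fin n)} (h : A ⊂ B) : M.gam A < M.gam B := by
  have := M.gam_sub h.1
  have := M.gam_pos (A := B \ A) (Finset.sdiff_nonempty.2 h.2)
  linarith

/-- A set contained in `A` or in `B` lies in `A ∪ B`, and one contained in both lies in `A ∩ B`;
sets meeting both differences are only counted in `A ∪ B`. -/
lemma alpha_supermodular (A B : Finset (Fin n)) :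
    M.alpha A + M.alpha B ≤ M.alpha (A ∪ B) + M.alpha (A ∩ B) := by
  have h1 : M.P A ∩ M.P B = M.P (A ∩ B) := by
    ext J
    simp only [Finset.mem_inter, mem_P, Finset.subset_inter_iff]
    tauto
  have h2 : M.P A ∪ M.P B ⊆ M.P (A ∪ B) :=
    Finset.union_subset (M.P_mono Finset.subset_union_left) (M.P_mono Finset.subset_union_right)
  rw [alpha, alpha, alpha, alpha, ← h1, ← Finset.sum_union_inter]
  gcongr
  exact fun J _ _ => M.a_nonneg J

lemma gam_modular (A B : Finset (Fin n)) :
    M.gam A + M.gam B = M.gam (A ∪ B) + M.gam (A ∩ B) :=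
  Finset.sum_union_inter.symm

/-- The gap `2 log 2 (γ(A) - γ(B)) - r² (α(A) - α(B))`, nonnegative when `r ≤ ρ(B, A)`. -/
def excess (r : ℝ) (B A : Finset (Fin n)) : ℝ :=
  2 * Real.log 2 * (M.gam A - M.gam B) - r ^ 2 * (M.alpha A - M.alpha B)

lemma log_two_pos : 0 < Real.log 2 := Real.log_pos one_lt_two

lemma rho_sq {B A : Finset (Fin n)} (h : M.Admissible B A) :
    M.rho B A ^ 2 * (M.alpha A - M.alpha B) = 2 * Real.log 2 * (M.gam A - M.gam B) := by
  have h1 : 0 < M.alpha A - M.alpha B := sub_pos.2 h.2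
  have h2 : 0 < M.gam A - M.gam B := sub_pos.2 (M.gam_lt h.1)
  have := log_two_pos
  rw [rho, Real.sq_sqrt (by positivity)]
  field_simp

lemma rho_pos {B A : Finset (Fin n)} (h : M.Admissible B A) : 0 < M.rho B A := by
  have h1 : 0 < M.alpha A - M.alpha B := sub_pos.2 h.2
  have h2 : 0 < M.gam A - M.gam B := sub_pos.2 (M.gam_lt h.1)
  have := log_two_pos
  exact Real.sqrt_pos.2 (by positivity)

section
variable (B : Finset (Fin n))

lemma finite_rho : {r | ∃ A, M.Admissible B A ∧ r = M.rho B A}.Finite :=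
  (Set.finite_range fun A => M.rho B A).subset (by rintro _ ⟨A, -, rfl⟩; exact ⟨A, rfl⟩)

lemma rhoHat_le {B A : Finset (Fin n)} (h : M.Admissible B A) : M.rhoHat B ≤ M.rho B A :=
  csInf_le (M.finite_rho B).bddBelow ⟨A, h, rfl⟩

variable {B} (hcover : ∀ i : Fin n, ∃ J ∈ M.P Finset.univ, i ∈ J) (hB : B ≠ Finset.univ)

include hcover hB in
lemma admissible_univ : M.Admissible B Finset.univ := by
  refine ⟨Finset.ssubset_univ_iff.2 hB, ?_⟩
  obtain ⟨i, hi⟩ : ∃ i, i ∉ B := by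
    by_contra! h
    exact hB (Finset.eq_univ_iff_forall.2 h)
  obtain ⟨J, hJ, hiJ⟩ := hcover i
  refine Finset.sum_lt_sum_of_subset (M.P_mono (Finset.subset_univ B)) hJ ?_
    (M.mem_P.1 hJ).2 fun J _ _ => M.a_nonneg J
  rw [mem_P]
  exact fun h => hi (h.1 hiJ)

include hcover hB in
lemma exists_minimiser : ∃ A, M.Admissible B A ∧ M.rho B A = M.rhoHat B := by
  have hne : {r | ∃ A, M.Admissible B A ∧ r = M.rho B A}.Nonempty :=
    ⟨_, _, M.admissible_univ hcover hB, rfl⟩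
  obtain ⟨A, hA, h⟩ := hne.csInf_mem (M.finite_rho B)
  exact ⟨A, hA, h.symm⟩

include hcover hB in
lemma rhoHat_pos : 0 < M.rhoHat B := by
  obtain ⟨A, hA, h⟩ := M.exists_minimiser hcover hB
  exact h ▸ M.rho_pos hA

include hcover hB in
lemma excess_rhoHat_nonneg {A : Finset (Fin n)} (hA : B ⊆ A) : 0 ≤ M.excess (M.rhoHat B) B A := by
  rw [excess]
  rcases eq_or_ne A B with rfl | hne
  · simp
  have hBA : B ⊂ A := Finset.ssubset_iff_subset_ne.2 ⟨hA, hne.symm⟩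
  have h2 : 0 < M.gam A - M.gam B := sub_pos.2 (M.gam_lt hBA)
  have hl := log_two_pos
  rcases (M.alpha_mono hA).eq_or_lt with h | h
  · rw [h]
    simp only [sub_self, mul_zero, sub_zero]
    positivity
  · have had : M.Admissible B A := ⟨hBA, h⟩
    have h1 : 0 < M.alpha A - M.alpha B := sub_pos.2 h
    rw [← M.rho_sq had, sub_nonneg]
    have := M.rhoHat_le had
    have := M.rhoHat_pos hcover hB
    gcongr

-- Replaces the quotient `ρ` by a linear quantity, for which unions and differences of sets can be
-- handled by modularity.
include hcover hB in
lemma minimiser_iff {A : Finset (Fin n)} (hA : B ⊂ A) :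
    (M.Admissible B A ∧ M.rho B A = M.rhoHat B) ↔ M.excess (M.rhoHat B) B A = 0 := by
  have h2 : 0 < M.gam A - M.gam B := sub_pos.2 (M.gam_lt hA)
  have hl := log_two_pos
  constructor
  · rintro ⟨had, h⟩
    rw [excess, ← h, M.rho_sq had, sub_self]
  · intro h
    have hne : M.alpha B < M.alpha A := by
      refine (M.alpha_mono hA.1).lt_of_ne fun he => ?_
      rw [excess, he] at h
      simp only [sub_self, mul_zero, sub_zero] at h
      exact (mul_pos (by positivity) h2).ne' h
    have had : M.Admissible B A := ⟨hA, hne⟩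
    refine ⟨had, ?_⟩
    have h1 : 0 < M.alpha A - M.alpha B := sub_pos.2 hne
    rw [excess, ← M.rho_sq had, ← sub_mul, mul_eq_zero, or_iff_left h1.ne', sub_eq_zero] at h
    exact (pow_left_inj₀ (M.rho_pos had).le (M.rhoHat_pos hcover hB).le two_ne_zero).1 h

-- The excess is submodular, as `γ` is modular and `α` supermodular. The excesses of `A ∪ A'` and `A
-- ∩ A'` are nonnegative and sum to at most 0, so both vanish.
include hcover hB in
lemma excess_union {A A' : Finset (Fin n)} (hA : B ⊆ A) (hA' : B ⊆ A')
    (h : M.excess (M.rhoHat B) B A = 0) (h' : M.excess (M.rhoHat B) B A' = 0) :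
    M.excess (M.rhoHat B) B (A ∪ A') = 0 := by
  have h1 := M.excess_rhoHat_nonneg hcover hB (Finset.subset_inter hA hA')
  have h2 := M.excess_rhoHat_nonneg hcover hB (hA.trans (Finset.subset_union_left (s₂ := A')))
  have h3 := M.alpha_supermodular A A'
  have h4 := M.gam_modular A A'
  have h5 := mul_le_mul_of_nonneg_left h3 (sq_nonneg (M.rhoHat B))
  have h6 := congrArg (2 * Real.log 2 * ·) h4
  simp only [excess] at *
  linarith

include hcover hB in
lemma excess_next : M.excess (M.rhoHat B) B (M.next B) = 0 := by
  classical
  have key : ∀ s : Finset (Finset (Fin n)),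
      (∀ A ∈ s, M.Admissible B A ∧ M.rho B A = M.rhoHat B) →
      M.excess (M.rhoHat B) B (B ∪ s.sup id) = 0 := by
    intro s
    induction s using Finset.induction_on with
    | empty => simp [excess]
    | insert A s _ ih =>
      intro h
      have hA := h A (Finset.mem_insert_self _ _)
      have h1 := M.excess_union hcover hB hA.1.1.1 Finset.subset_union_left
        ((M.minimiser_iff hcover hB hA.1.1).1 hA)
        (ih fun A' hA' => h A' (Finset.mem_insert_of_mem hA'))
      rw [Finset.sup_insert, id, Finset.sup_eq_union, Finset.union_left_comm]
      exact h1
  rw [next]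
  convert key _ _
  intro A hA
  simpa using hA

include hcover hB in
lemma subset_next {A : Finset (Fin n)} (hA : B ⊂ A) (h : M.excess (M.rhoHat B) B A = 0) :
    A ⊆ M.next B := by
  classical
  refine Finset.Subset.trans ?_ Finset.subset_union_right
  refine Finset.le_sup (f := id) ?_
  simpa using (M.minimiser_iff hcover hB hA).2 h

include hcover hB in
lemma ssubset_next : B ⊂ M.next B := by
  obtain ⟨A, hA⟩ := M.exists_minimiser hcover hB
  exact hA.1.1.trans_subset
    (M.subset_next hcover hB hA.1.1 ((M.minimiser_iff hcover hB hA.1.1).1 hA))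

-- A minimiser `A` for `next B` is strictly larger than the largest minimiser for `B`, so its excess
-- over `B` is positive while that of `next B` is 0. Their difference compares the two slopes on the
-- increment from `next B` to `A`.
include hcover hB in
lemma rhoHat_lt_rhoHat_next (h : M.next B ≠ Finset.univ) : M.rhoHat B < M.rhoHat (M.next B) := by
  obtain ⟨A, hA, hr⟩ := M.exists_minimiser hcover h
  have hBA : B ⊂ A := (M.ssubset_next hcover hB).trans hA.1
  have h1 : 0 < M.excess (M.rhoHat B) B A := by
    refine (M.excess_rhoHat_nonneg hcover hB hBA.1).lt_of_ne fun he => ?_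
    exact hA.1.2 (M.subset_next hcover hB hBA he.symm)
  have h2 := M.excess_next hcover hB
  have h3 := M.rho_sq hA
  have h4 : 0 < M.alpha A - M.alpha (M.next B) := sub_pos.2 hA.2
  have h5 : M.rhoHat B ^ 2 * (M.alpha A - M.alpha (M.next B)) <
      M.rhoHat (M.next B) ^ 2 * (M.alpha A - M.alpha (M.next B)) := by
    rw [hr] at h3
    rw [h3]
    simp only [excess] at h1 h2
    linarith
  exact lt_of_pow_lt_pow_left₀ 2 (M.rhoHat_pos hcover h).le (lt_of_mul_lt_mul_right h5 h4.le)

end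

section
variable (hcover : ∀ i : Fin n, ∃ J ∈ M.P Finset.univ, i ∈ J) {l : ℕ} (hl : 1 ≤ l) (hK : l ≤ M.K)

lemma chain_ne_univ {l : ℕ} (h : l < M.K) : M.chain l ≠ Finset.univ :=
  Nat.notMem_of_lt_sInf (s := {k | M.chain k = Finset.univ}) h

lemma beta_eq {l : ℕ} (hl : 1 ≤ l) : M.beta l = M.rhoHat (M.chain (l - 1)) := by
  obtain ⟨l, rfl⟩ := Nat.exists_eq_add_of_le' hl
  rfl

lemma chain_eq {l : ℕ} (hl : 1 ≤ l) : M.chain l = M.next (M.chain (l - 1)) := by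
  obtain ⟨l, rfl⟩ := Nat.exists_eq_add_of_le' hl
  rfl

include hcover hl hK

lemma beta_pos : 0 < M.beta l := by
  rw [M.beta_eq hl]
  exact M.rhoHat_pos hcover (M.chain_ne_univ (by omega))

lemma excess_beta_nonneg {A : Finset (Fin n)} (hA : M.chain (l - 1) ⊆ A) :
    0 ≤ M.excess (M.beta l) (M.chain (l - 1)) A := by
  rw [M.beta_eq hl]
  exact M.excess_rhoHat_nonneg hcover (M.chain_ne_univ (by omega)) hA

/-- The balance of energy and entropy on a level: `exp (-β_l² Δ_l N / 2)` is the inverse of `2 ^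
((γ(A_l) - γ(A_{l-1})) N)`. -/
lemma beta_sq_mul_Delta :
    M.beta l ^ 2 * M.Delta l = 2 * Real.log 2 * (M.gam (M.chain l) - M.gam (M.chain (l - 1))) := by
  have h := M.excess_next hcover (M.chain_ne_univ (l := l - 1) (by omega))
  rw [← M.chain_eq hl, ← M.beta_eq hl, excess, sub_eq_zero] at h
  exact h.symm

lemma chain_ssubset : M.chain (l - 1) ⊂ M.chain l := by
  have h := M.ssubset_next hcover (M.chain_ne_univ (l := l - 1) (by omega))
  rwa [← M.chain_eq hl] at h

lemma Delta_pos : 0 < M.Delta l := by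
  have h1 := M.beta_sq_mul_Delta hcover hl hK
  have h2 : 0 < M.gam (M.chain l) - M.gam (M.chain (l - 1)) :=
    sub_pos.2 (M.gam_lt (M.chain_ssubset hcover hl hK))
  have h3 := log_two_pos
  have h4 : 0 < M.beta l ^ 2 * M.Delta l := by rw [h1]; positivity
  exact pos_of_mul_pos_right h4 (sq_nonneg _)

omit hl hK in
lemma beta_lt {l : ℕ} (hl : 1 ≤ l) (hK : l + 1 ≤ M.K) : M.beta l < M.beta (l + 1) := by
  rw [M.beta_eq hl, M.beta_eq (by omega), Nat.add_sub_cancel]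
  have h := M.rhoHat_lt_rhoHat_next hcover (M.chain_ne_univ (l := l - 1) (by omega))
  rw [← M.chain_eq hl] at h
  exact h (M.chain_ne_univ (by omega))

end

end GREM

/-! ### Exponential measures dominating gaussian laws -/

/-- The measure `exp (-b x) dx` on the real line. -/
def expWeight (b : ℝ) : Measure ℝ :=
  volume.withDensity fun x => ENNReal.ofReal (Real.exp (-b * x))

lemma setLIntegral_exp_Iic {c : ℝ} (hc : 0 < c) (t : ℝ) :
    ∫⁻ x in Set.Iic t, ENNReal.ofReal (Real.exp (c * x)) = ENNReal.ofReal (Real.exp (c * t) / c) := by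
  rw [← ofReal_integral_eq_lintegral_ofReal (integrableOn_exp_mul_Iic hc t)
    (ae_of_all _ fun x => (Real.exp_pos _).le), integral_exp_mul_Iic hc]

lemma expWeight_Ici {b : ℝ} (hb : 0 < b) (t : ℝ) :
    expWeight b (Set.Ici t) = ENNReal.ofReal (Real.exp (-b * t) / b) := by
  rw [expWeight, withDensity_apply _ measurableSet_Ici, setLIntegral_congr Ioi_ae_eq_Ici.symm,
    ← ofReal_integral_eq_lintegral_ofReal (integrableOn_exp_mul_Ioi (neg_lt_zero.2 hb) t)
    (ae_of_all _ fun x => (Real.exp_pos _).le), integral_exp_mul_Ioi (neg_lt_zero.2 hb)]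
  congr 1
  field_simp

lemma expWeight_Icc_le {b : ℝ} (hb : 0 ≤ b) (x y : ℝ) :
    expWeight b (Set.Icc x y) ≤ ENNReal.ofReal (Real.exp (-b * x) * (y - x)) := by
  rw [expWeight, withDensity_apply _ measurableSet_Icc, ENNReal.ofReal_mul (Real.exp_pos _).le,
    ← Real.volume_Icc, ← setLIntegral_const]
  refine setLIntegral_mono' measurableSet_Icc fun z hz => ?_
  gcongr ENNReal.ofReal (Real.exp ?_)
  nlinarith [hz.1]

lemma measurableSet_add_mem (s : ℝ) {E : Set ℝ} (hE : MeasurableSet E) :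
    MeasurableSet {x | s + x ∈ E} :=
  measurable_const_add s hE

/-- Translation only multiplies this measure by a constant, so conditioning on an independent
summand costs an exponential factor and nothing else. -/
lemma expWeight_preimage_add (b s : ℝ) {E : Set ℝ} (hE : MeasurableSet E) :
    expWeight b {x | s + x ∈ E} = ENNReal.ofReal (Real.exp (b * s)) * expWeight b E := by
  rw [expWeight, withDensity_apply _ hE, withDensity_apply _ (measurableSet_add_mem s hE),
    ← lintegral_const_mul _ (by fun_prop),
    ← (measurePreserving_add_left volume s).setLIntegral_comp_preimage hE (by fun_prop)]
  refine setLIntegral_congr_fun (measurable_const_add s hE) fun x _ => ?_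
  rw [← ENNReal.ofReal_mul (Real.exp_pos _).le, ← Real.exp_add]
  ring_nf

lemma setLIntegral_exp_expWeight {b b' : ℝ} (h : b < b') (t : ℝ) :
    ∫⁻ x in Set.Iic t, ENNReal.ofReal (Real.exp (b' * x)) ∂(expWeight b) =
      ENNReal.ofReal (Real.exp ((b' - b) * t) / (b' - b)) := by
  rw [← setLIntegral_exp_Iic (sub_pos.2 h) t, expWeight,
    setLIntegral_withDensity_eq_setLIntegral_mul _ (by fun_prop) (by fun_prop) measurableSet_Iic]
  refine setLIntegral_congr_fun measurableSet_Iic fun x _ => ?_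
  simp only [Pi.mul_apply]
  rw [← ENNReal.ofReal_mul (Real.exp_pos _).le, ← Real.exp_add]
  ring_nf

/-- The constant with which `expWeight b` dominates the centered gaussian law of variance `v`. -/
def gaussConst (b v : ℝ) : ℝ := (√(2 * Real.pi * v))⁻¹ * Real.exp (b ^ 2 * v / 2)

lemma gaussConst_nonneg (b v : ℝ) : 0 ≤ gaussConst b v := by
  unfold gaussConst; positivity

/-- Completing the square: `-x² / (2v) ≤ b² v / 2 - b x`, with equality at `x = b v`. No relation
between `b` and `v` is needed. -/
lemma gaussianReal_le_expWeight (b : ℝ) {v : ℝ} (hv : 0 < v) :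
    gaussianReal 0 v.toNNReal ≤ ENNReal.ofReal (gaussConst b v) • expWeight b := by
  rw [gaussianReal_of_var_ne_zero 0 (by simpa using hv), expWeight,
    ← withDensity_smul _ (by fun_prop)]
  refine withDensity_mono (ae_of_all _ fun x => ?_)
  rw [Pi.smul_apply, smul_eq_mul, ← ENNReal.ofReal_mul (gaussConst_nonneg b v), gaussianPDF,
    gaussianPDFReal, gaussConst, Real.coe_toNNReal v hv.le, mul_assoc (√_)⁻¹,
    ← Real.exp_add]
  gcongr
  rw [sub_zero, div_le_iff₀ (by positivity)]
  nlinarith [sq_nonneg (x - b * v)]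

lemma measurable_mem_prodMk {α : Type*} [MeasurableSpace α] {G : Set α} {S : α → ℝ}
    (hG : MeasurableSet G) (hS : Measurable S) : Measurable fun ω => (ω ∈ G, S ω) :=
  Measurable.prodMk (measurableSet_setOfPred.1 hG) hS

/-! ### Probability bounds for sums of independent variables -/

section
variable {Ω : Type*} {m₁ m₂ : MeasurableSpace Ω} [m : MeasurableSpace Ω] {Pr : Measure Ω}
  [IsProbabilityMeasure Pr]

lemma measure_prodMk_mem_of_indep {α β : Type*} [MeasurableSpace α] [MeasurableSpace β]
    (h₁ : m₁ ≤ m) (h₂ : m₂ ≤ m) (h : Indep m₁ m₂ Pr)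
    {U : Ω → α} {W : Ω → β} (hU : Measurable[m₁] U) (hW : Measurable[m₂] W)
    {B : Set (α × β)} (hB : MeasurableSet B) :
    Pr {ω | (U ω, W ω) ∈ B} = ∫⁻ ω, Pr.map W (Prod.mk (U ω) ⁻¹' B) ∂Pr := by
  have hU' : Measurable U := hU.mono h₁ le_rfl
  have hW' : Measurable W := hW.mono h₂ le_rfl
  have hind : IndepFun U W Pr :=
    (IndepFun_iff_Indep _ _ _).2
      (indep_of_indep_of_le_left (indep_of_indep_of_le_right h hW.comap_le) hU.comap_le)
  have hmap := (indepFun_iff_map_prod_eq_prod_map_map hU'.aemeasurable hW'.aemeasurable).1 hind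
  have : IsProbabilityMeasure (Pr.map W) := Measure.isProbabilityMeasure_map hW'.aemeasurable
  rw [← lintegral_map (f := fun u => Pr.map W (Prod.mk u ⁻¹' B))
    (measurable_measure_prodMk_left hB) hU', ← Measure.prod_apply hB, ← hmap,
    Measure.map_apply (hU'.prodMk hW') hB]
  rfl

/-- By induction, the law of the partial sum on the event of the earlier constraints is dominated by
a multiple of `expWeight (b l)`. Adding an independent `V (l + 1)` produces `exp (b (l + 1) x)`,
whose integral against `exp (-b l x) dx` up to `t l` converges because `b l < b (l + 1)`. -/
lemma measure_partialSums_le {V : ℕ → Ω → ℝ} {𝓖 : ℕ → MeasurableSpace Ω} (h𝓖 : ∀ l, 𝓖 l ≤ m)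
    (hmono : Monotone 𝓖) (hV : ∀ l, Measurable[𝓖 l] (V l))
    (hind : ∀ l, Indep (𝓖 l) (MeasurableSpace.comap (V (l + 1)) inferInstance) Pr)
    {j : ℕ} {c b : ℕ → ℝ} (t : ℕ → ℝ) (hc : ∀ l, 0 ≤ c l)
    (hlaw : ∀ l, 1 ≤ l → l ≤ j → Pr.map (V l) ≤ ENNReal.ofReal (c l) • expWeight (b l))
    (hb : ∀ l, 1 ≤ l → l + 1 ≤ j → b l < b (l + 1)) {l : ℕ} (hl : 1 ≤ l) (hlj : l ≤ j)
    {E : Set ℝ} (hE : MeasurableSet E) :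
    Pr {ω | (∀ i ∈ Finset.Ico 1 l, ∑ q ∈ Finset.Icc 1 i, V q ω ≤ t i) ∧
        ∑ q ∈ Finset.Icc 1 l, V q ω ∈ E} ≤
      ENNReal.ofReal ((∏ i ∈ Finset.Icc 1 l, c i) *
        ∏ i ∈ Finset.Ico 1 l, (Real.exp ((b (i + 1) - b i) * t i) / (b (i + 1) - b i))) *
        expWeight (b l) E := by
  have hVm : ∀ l, Measurable (V l) := fun l => (hV l).mono (h𝓖 l) le_rfl
  have hS : ∀ i l, i ≤ l → Measurable[𝓖 l] fun ω => ∑ q ∈ Finset.Icc 1 i, V q ω := fun i l h =>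
    Finset.measurable_fun_sum _ fun q hq =>
      (hV q).mono (hmono ((Finset.mem_Icc.1 hq).2.trans h)) le_rfl
  induction l, hl using Nat.le_induction generalizing E with
  | base =>
    have := hlaw 1 le_rfl hlj E
    rw [Measure.map_apply (hVm 1) hE] at this
    simpa [Set.preimage] using this
  | succ l hl ih =>
    set G : Set Ω := {ω | ∀ i ∈ Finset.Ico 1 l, ∑ q ∈ Finset.Icc 1 i, V q ω ≤ t i} with hG
    set S : Ω → ℝ := fun ω => ∑ q ∈ Finset.Icc 1 l, V q ω with hSdef
    have hGm : MeasurableSet[𝓖 l] G := by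
      have : G = ⋂ i ∈ Finset.Ico 1 l, {ω | ∑ q ∈ Finset.Icc 1 i, V q ω ≤ t i} := by
        ext ω; simp [hG]
      rw [this]
      refine Finset.measurableSet_biInter _ fun i hi => ?_
      exact (hS i l (Finset.mem_Ico.1 hi).2.le) measurableSet_Iic
    have hSm : Measurable S := (hS l l le_rfl).mono (h𝓖 l) le_rfl
    have hd : 0 < b (l + 1) - b l := sub_pos.2 (hb l hl hlj)
    have hle : (Pr.restrict G).map S ≤ ENNReal.ofReal ((∏ i ∈ Finset.Icc 1 l, c i) *
        ∏ i ∈ Finset.Ico 1 l, (Real.exp ((b (i + 1) - b i) * t i) / (b (i + 1) - b i))) •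
        expWeight (b l) := by
      refine Measure.le_iff.2 fun F hF => ?_
      rw [Measure.map_apply hSm hF, Measure.restrict_apply (hSm hF), Set.inter_comm]
      exact ih (by omega) hF
    let U : Ω → Prop × ℝ := fun ω => (ω ∈ G, S ω)
    have hU : Measurable[𝓖 l] U := @measurable_mem_prodMk Ω (𝓖 l) G S hGm (hS l l le_rfl)
    let B : Set ((Prop × ℝ) × ℝ) := {p | p.1.1 ∧ p.1.2 ≤ t l ∧ p.1.2 + p.2 ∈ E}
    have hB : MeasurableSet B := by
      refine MeasurableSet.inter ?_ (MeasurableSet.inter ?_ ?_)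
      · exact measurableSet_setOfPred.2 (measurable_fst.comp measurable_fst)
      · exact measurableSet_le (measurable_snd.comp measurable_fst) measurable_const
      · exact (measurable_snd.comp measurable_fst).add measurable_snd hE
    have key := measure_prodMk_mem_of_indep (h𝓖 l) (hVm (l + 1)).comap_le (hind l) hU
      (comap_measurable _) hB
    have hset : {ω | (∀ i ∈ Finset.Ico 1 (l + 1), ∑ q ∈ Finset.Icc 1 i, V q ω ≤ t i) ∧
        ∑ q ∈ Finset.Icc 1 (l + 1), V q ω ∈ E} = {ω | (U ω, V (l + 1) ω) ∈ B} := by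
      ext ω
      simp only [Set.mem_ofPred_eq, U, B, hG, hSdef]
      rw [Finset.sum_Icc_succ_top (by omega), ← Order.succ_eq_add_one l,
        ← Finset.insert_Ico_right_eq_Ico_succ (by omega)]
      simp only [Finset.mem_insert, forall_eq_or_imp]
      tauto
    rw [hset, key]
    calc ∫⁻ ω, Pr.map (V (l + 1)) (Prod.mk (U ω) ⁻¹' B) ∂Pr
        ≤ ∫⁻ ω in G, (Set.Iic (t l)).indicator (fun x => ENNReal.ofReal (c (l + 1)) *
            (ENNReal.ofReal (Real.exp (b (l + 1) * x)) * expWeight (b (l + 1)) E)) (S ω) ∂Pr := by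
          rw [← lintegral_indicator (h𝓖 l _ hGm)]
          refine lintegral_mono fun ω => ?_
          by_cases hω : ω ∈ G ∧ S ω ≤ t l
          · rw [Set.indicator_of_mem hω.1, Set.indicator_of_mem (Set.mem_Iic.2 hω.2),
              ← expWeight_preimage_add _ _ hE]
            refine le_trans (measure_mono ?_) (hlaw (l + 1) (by omega) hlj {x | S ω + x ∈ E})
            exact fun x hx => hx.2.2
          · have : Prod.mk (U ω) ⁻¹' B = ∅ := by
              ext x
              simp only [U, B, Set.mem_preimage, Set.mem_ofPred_eq, Set.mem_empty_iff_false, iff_false]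
              tauto
            simp [this]
      _ = ∫⁻ x in Set.Iic (t l), ENNReal.ofReal (c (l + 1)) *
            (ENNReal.ofReal (Real.exp (b (l + 1) * x)) * expWeight (b (l + 1)) E)
              ∂((Pr.restrict G).map S) := by
          rw [← lintegral_indicator measurableSet_Iic, lintegral_map _ hSm]
          exact Measurable.indicator (by fun_prop) measurableSet_Iic
      _ ≤ ∫⁻ x in Set.Iic (t l), ENNReal.ofReal (c (l + 1)) *
            (ENNReal.ofReal (Real.exp (b (l + 1) * x)) * expWeight (b (l + 1)) E)
              ∂(ENNReal.ofReal ((∏ i ∈ Finset.Icc 1 l, c i) * ∏ i ∈ Finset.Ico 1 l,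
                (Real.exp ((b (i + 1) - b i) * t i) / (b (i + 1) - b i))) • expWeight (b l)) :=
          lintegral_mono' (Measure.restrict_mono le_rfl hle) le_rfl
      _ = _ := by
          rw [Measure.restrict_smul, lintegral_smul_measure, lintegral_const_mul _ (by fun_prop),
            lintegral_mul_const _ (by fun_prop), setLIntegral_exp_expWeight (hb l hl hlj),
            Finset.prod_Icc_succ_top (by omega), Finset.prod_Ico_succ_top hl, smul_eq_mul,
            ← mul_assoc, ← mul_assoc]
          congr 1
          have h1 : 0 ≤ ∏ i ∈ Finset.Icc 1 l, c i := Finset.prod_nonneg fun i _ => hc i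
          have h2 : 0 ≤ ∏ i ∈ Finset.Ico 1 l,
              (Real.exp ((b (i + 1) - b i) * t i) / (b (i + 1) - b i)) :=
            Finset.prod_nonneg fun i hi => div_nonneg (Real.exp_pos _).le
              (sub_nonneg.2 (hb i (Finset.mem_Ico.1 hi).1
                (by have := (Finset.mem_Ico.1 hi).2; omega)).le)
          rw [← ENNReal.ofReal_mul (mul_nonneg h1 h2),
            ← ENNReal.ofReal_mul (mul_nonneg (mul_nonneg h1 h2) (hc _))]
          congr 1
          ring

/-- Given `Y = y`, each of the two windows has probability at most a constant times `exp (b y)`.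
Their product `exp (2 b y)` integrates against `exp (-b y) dy` only up to a finite threshold: this
is why the shared variable `Y` has to be truncated. -/
lemma measure_shared_le {Y Z Z' : Ω → ℝ} (hY : Measurable Y) (hZ : Measurable Z)
    (hZ' : Measurable Z') (hYZ : IndepFun Y (fun ω => (Z ω, Z' ω)) Pr) (hZZ : IndepFun Z Z' Pr)
    {A A' b : ℝ} (hb : 0 < b) (hA : 0 ≤ A) (hA' : 0 ≤ A')
    (lawY : Pr.map Y ≤ ENNReal.ofReal A • expWeight b)
    (lawZ : Pr.map Z ≤ ENNReal.ofReal A' • expWeight b)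
    (lawZ' : Pr.map Z' ≤ ENNReal.ofReal A' • expWeight b) {p q : ℝ} (hpq : p ≤ q) (t : ℝ) :
    Pr {ω | Y ω ≤ t ∧ Y ω + Z ω ∈ Set.Icc p q ∧ Y ω + Z' ω ∈ Set.Icc p q} ≤
      ENNReal.ofReal (A * (A' * (Real.exp (-b * p) * (q - p))) ^ 2 * (Real.exp (b * t) / b)) := by
  have hqp := sub_nonneg.2 hpq
  let B : Set (ℝ × (ℝ × ℝ)) :=
    {x | x.1 ≤ t ∧ x.1 + x.2.1 ∈ Set.Icc p q ∧ x.1 + x.2.2 ∈ Set.Icc p q}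
  have hB : MeasurableSet B := by
    refine MeasurableSet.inter ?_ (MeasurableSet.inter ?_ ?_)
    · exact measurable_fst measurableSet_Iic
    · exact (measurable_fst.add (measurable_fst.comp measurable_snd)) measurableSet_Icc
    · exact (measurable_fst.add (measurable_snd.comp measurable_snd)) measurableSet_Icc
  have key := measure_prodMk_mem_of_indep hY.comap_le (hZ.prodMk hZ').comap_le
    ((IndepFun_iff_Indep _ _ _).1 hYZ) (comap_measurable Y)
    (comap_measurable (fun ω => (Z ω, Z' ω))) hB
  have bound : ∀ {W : Ω → ℝ}, Measurable W → Pr.map W ≤ ENNReal.ofReal A' • expWeight b → ∀ y,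
      Pr {ω | y + W ω ∈ Set.Icc p q} ≤
        ENNReal.ofReal (A' * (Real.exp (-b * p) * (q - p))) * ENNReal.ofReal (Real.exp (b * y)) := by
    intro W hW lawW y
    have h1 := lawW {x | y + x ∈ Set.Icc p q}
    rw [Measure.map_apply hW (measurableSet_add_mem y measurableSet_Icc)] at h1
    refine h1.trans ?_
    rw [Measure.smul_apply, smul_eq_mul, expWeight_preimage_add _ _ measurableSet_Icc,
      ENNReal.ofReal_mul hA', mul_comm (ENNReal.ofReal (Real.exp (b * y))), mul_assoc]
    gcongr
    exact expWeight_Icc_le hb.le _ _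
  set κ := A' * (Real.exp (-b * p) * (q - p)) with hκ
  have hκ0 : 0 ≤ κ := by positivity
  calc Pr {ω | Y ω ≤ t ∧ Y ω + Z ω ∈ Set.Icc p q ∧ Y ω + Z' ω ∈ Set.Icc p q}
      = ∫⁻ ω, Pr.map (fun ω => (Z ω, Z' ω)) (Prod.mk (Y ω) ⁻¹' B) ∂Pr := key
    _ ≤ ∫⁻ ω, (Set.Iic t).indicator (fun y => ENNReal.ofReal (κ ^ 2) *
          ENNReal.ofReal (Real.exp (2 * b * y))) (Y ω) ∂Pr := by
        refine lintegral_mono fun ω => ?_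
        by_cases hω : Y ω ≤ t
        · rw [Set.indicator_of_mem (Set.mem_Iic.2 hω),
            Measure.map_apply (hZ.prodMk hZ') (measurable_prodMk_left hB)]
          have hsub : (fun ω => (Z ω, Z' ω)) ⁻¹' (Prod.mk (Y ω) ⁻¹' B) ⊆
              Z ⁻¹' {x | Y ω + x ∈ Set.Icc p q} ∩ Z' ⁻¹' {x | Y ω + x ∈ Set.Icc p q} :=
            fun x hx => hx.2
          refine (measure_mono hsub).trans ?_
          rw [hZZ.measure_inter_preimage_eq_mul _ _
            (measurableSet_add_mem (Y ω) measurableSet_Icc)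
            (measurableSet_add_mem (Y ω) measurableSet_Icc)]
          refine (mul_le_mul' (bound hZ lawZ (Y ω)) (bound hZ' lawZ' (Y ω))).trans_eq ?_
          rw [← ENNReal.ofReal_mul hκ0, ← ENNReal.ofReal_mul (by positivity),
            ← ENNReal.ofReal_mul (by positivity)]
          congr 1
          rw [show 2 * b * Y ω = b * Y ω + b * Y ω by ring, Real.exp_add]
          ring
        · have : Prod.mk (Y ω) ⁻¹' B = ∅ := by
            ext x
            simp only [B, Set.mem_preimage, Set.mem_ofPred_eq, Set.mem_empty_iff_false, iff_false]
            tauto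
          simp [this]
    _ = ∫⁻ y in Set.Iic t, ENNReal.ofReal (κ ^ 2) *
          ENNReal.ofReal (Real.exp (2 * b * y)) ∂(Pr.map Y) := by
        rw [← lintegral_indicator measurableSet_Iic, lintegral_map _ hY]
        exact Measurable.indicator (by fun_prop) measurableSet_Iic
    _ ≤ ∫⁻ y in Set.Iic t, ENNReal.ofReal (κ ^ 2) *
          ENNReal.ofReal (Real.exp (2 * b * y)) ∂(ENNReal.ofReal A • expWeight b) :=
        lintegral_mono' (Measure.restrict_mono le_rfl lawY) le_rfl
    _ = _ := by
        rw [Measure.restrict_smul, lintegral_smul_measure, lintegral_const_mul _ (by fun_prop),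
          setLIntegral_exp_expWeight (by linarith : b < 2 * b), smul_eq_mul,
          ← ENNReal.ofReal_mul (by positivity), ← ENNReal.ofReal_mul hA]
        congr 1
        ring_nf

-- A union bound in which configurations are counted only through the coordinates `f` on which the
-- event depends.
omit [IsProbabilityMeasure Pr] in
lemma measure_exists_le_card_mul {ι κ : Type*} [Fintype κ] (E : ι → Set Ω) (f : ι → κ)
    (hf : ∀ x y, f x = f y → E x = E y) {p : ENNReal} (hp : ∀ x, Pr (E x) ≤ p) :
    Pr {ω | ∃ x, ω ∈ E x} ≤ Fintype.card κ * p := by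
  classical
  calc Pr {ω | ∃ x, ω ∈ E x} ≤ Pr (⋃ k : κ, ⋃ x : {x // f x = k}, E x) := by
        refine measure_mono ?_
        rintro ω ⟨x, hx⟩
        exact Set.mem_iUnion.2 ⟨f x, Set.mem_iUnion.2 ⟨⟨x, rfl⟩, hx⟩⟩
    _ ≤ ∑ k : κ, Pr (⋃ x : {x // f x = k}, E x) := measure_iUnion_fintype_le _ _
    _ ≤ ∑ _k : κ, p := by
        refine Finset.sum_le_sum fun k _ => ?_
        by_cases hk : ∃ x, f x = k
        · obtain ⟨x, rfl⟩ := hk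
          refine (measure_mono (Set.iUnion_subset fun y => ?_)).trans (hp x)
          exact (hf _ _ y.2).le
        · have : IsEmpty {x // f x = k} := ⟨fun y => hk ⟨y, y.2⟩⟩
          simp
    _ = _ := by simp

end

/-! ### Disorder variables: generated σ-algebras, independence and laws of energies -/

namespace GREM

variable {n : ℕ} (M : GREM n)

/-- The full configurations `Σ_{N,I}`. -/
abbrev Full (N : ℕ) : Type := (i : Fin n) → Fin (M.size N i)

/-- The index set of the disorder variables. -/
abbrev Site (N : ℕ) : Type := Σ J : {J // J ∈ M.P Finset.univ}, M.Conf N J.1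

variable {M} {N : ℕ} {Ω : Type*}

/-- The sum of the variables `X J σ_J` over `J ∈ L`. -/
def en (X : (J : Finset (Fin n)) → M.Conf N J → Ω → ℝ) (L : Finset (Finset (Fin n)))
    (σ : M.Full N) (ω : Ω) : ℝ :=
  ∑ J ∈ L, X J (J.restrict σ) ω

/-- The indices of the variables that occur in `en X L σ`. -/
def sites (L : Finset (Finset (Fin n))) (σ : M.Full N) : Set (M.Site N) :=
  {p | p.1.1 ∈ L ∧ p.2 = p.1.1.restrict σ}

/-- The σ-algebra generated by the variables with index in `T`. -/
abbrev sig (X : (J : Finset (Fin n)) → M.Conf N J → Ω → ℝ) (T : Set (M.Site N)) :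
    MeasurableSpace Ω :=
  ⨆ p ∈ T, MeasurableSpace.comap (X p.1.1 p.2) inferInstance

section
variable {X : (J : Finset (Fin n)) → M.Conf N J → Ω → ℝ}

lemma sig_mono {S T : Set (M.Site N)} (h : S ⊆ T) : sig X S ≤ sig X T :=
  biSup_mono h

lemma measurable_en {L : Finset (Finset (Fin n))} (hL : L ⊆ M.P Finset.univ) {σ : M.Full N}
    {T : Set (M.Site N)} (hT : sites L σ ⊆ T) : Measurable[sig X T] (en X L σ) := by
  refine @Finset.measurable_fun_sum _ _ _ _ _ _ (sig X T) _ L fun J hJ => ?_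
  have h1 : (⟨⟨J, hL hJ⟩, J.restrict σ⟩ : M.Site N) ∈ T := hT ⟨hJ, rfl⟩
  refine (comap_measurable (X J (J.restrict σ))).mono ?_ le_rfl
  exact le_biSup (fun p : M.Site N => MeasurableSpace.comap (X p.1.1 p.2) inferInstance) h1

lemma en_union {L L' : Finset (Finset (Fin n))} (h : Disjoint L L') (σ : M.Full N) (ω : Ω) :
    en X (L ∪ L') σ ω = en X L σ ω + en X L' σ ω :=
  Finset.sum_union h

lemma en_congr {L : Finset (Finset (Fin n))} {σ τ : M.Full N}
    (h : ∀ J ∈ L, ∀ i ∈ J, σ i = τ i) : en X L σ = en X L τ := by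
  funext ω
  refine Finset.sum_congr rfl fun J hJ => ?_
  have : J.restrict σ = J.restrict τ := funext fun i => h J hJ i i.2
  rw [this]

lemma disjoint_sites {L L' : Finset (Finset (Fin n))} {σ τ : M.Full N}
    (h : ∀ J ∈ L, J ∈ L' → ∃ i ∈ J, σ i ≠ τ i) : Disjoint (sites L σ) (sites L' τ) := by
  rw [Set.disjoint_left]
  rintro ⟨J, c⟩ ⟨h1, h1'⟩ ⟨h2, h3⟩
  obtain ⟨i, hi, hne⟩ := h J h1 h2
  exact hne (congrFun (h1'.symm.trans h3) ⟨i, hi⟩)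

variable [m : MeasurableSpace Ω] {Pr : Measure Ω}

lemma sig_le (hm : ∀ J τ, Measurable (X J τ)) (T : Set (M.Site N)) : sig X T ≤ m :=
  iSup₂_le fun p _ => (hm p.1.1 p.2).comap_le

lemma indep_sig (hX : M.IsDisorder Pr X) (hm : ∀ J τ, Measurable (X J τ)) {S T : Set (M.Site N)}
    (h : Disjoint S T) : Indep (sig X S) (sig X T) Pr :=
  indep_iSup_of_disjoint (fun p : M.Site N => (hm p.1.1 p.2).comap_le)
    ((iIndepFun_iff_iIndep _ _ _).1 hX.indep) h

lemma measurable_en' (hm : ∀ J τ, Measurable (X J τ)) (L : Finset (Finset (Fin n)))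
    (σ : M.Full N) : Measurable (en X L σ) :=
  Finset.measurable_fun_sum _ fun J _ => hm J _

lemma indepFun_of_disjoint (hX : M.IsDisorder Pr X) (hm : ∀ J τ, Measurable (X J τ))
    {α β : Type*} [MeasurableSpace α] [MeasurableSpace β]
    {S T : Set (M.Site N)} (h : Disjoint S T) {U : Ω → α} {W : Ω → β}
    (hU : Measurable[sig X S] U) (hW : Measurable[sig X T] W) : IndepFun U W Pr :=
  (IndepFun_iff_Indep _ _ _).2 (indep_of_indep_of_le_left
    (indep_of_indep_of_le_right (indep_sig hX hm h) hW.comap_le) hU.comap_le)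

lemma map_en [IsProbabilityMeasure Pr] (hX : M.IsDisorder Pr X)
    (hm : ∀ J τ, Measurable (X J τ)) {L : Finset (Finset (Fin n))}
    (hL : L ⊆ M.P Finset.univ) (σ : M.Full N) :
    Pr.map (en X L σ) = gaussianReal 0 ((∑ J ∈ L, M.a J) * N).toNNReal := by
  classical
  induction L using Finset.induction_on with
  | empty =>
    have : en X ∅ σ = fun _ => (0 : ℝ) := by funext ω; simp [en]
    rw [this, Measure.map_const]
    simp
  | insert J L hJ ih =>
    have hJP := hL (Finset.mem_insert_self J L)
    have hLP : L ⊆ M.P Finset.univ := (Finset.subset_insert J L).trans hL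
    have hJP' : ({J} : Finset (Finset (Fin n))) ⊆ M.P Finset.univ := by simpa using hJP
    have hsum : en X (insert J L) σ = en X {J} σ + en X L σ := by
      funext ω
      simp [en, Finset.sum_insert hJ]
    have hind : IndepFun (en X {J} σ) (en X L σ) Pr := by
      refine indepFun_of_disjoint hX hm (disjoint_sites (σ := σ) (τ := σ) (L := {J}) (L' := L) ?_)
        (measurable_en hJP' le_rfl) (measurable_en hLP le_rfl)
      intro J' h1 h2
      rw [Finset.mem_singleton.1 h1] at h2
      exact absurd h2 hJ
    have h1 : Pr.map (en X {J} σ) = gaussianReal 0 (M.a J * N).toNNReal := by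
      have : en X {J} σ = X J (J.restrict σ) := by funext ω; simp [en]
      rw [this]
      exact (hX.hasLaw J hJP _).map_eq
    have ha := M.a_nonneg J
    have hs : 0 ≤ ∑ J ∈ L, M.a J := Finset.sum_nonneg fun J _ => M.a_nonneg J
    rw [hsum, gaussianReal_add_gaussianReal_of_indepFun hind h1 (ih hLP), Finset.sum_insert hJ,
      add_mul, Real.toNNReal_add (by positivity) (by positivity), add_zero]

lemma map_en_le [IsProbabilityMeasure Pr] (hX : M.IsDisorder Pr X)
    (hm : ∀ J τ, Measurable (X J τ)) {L : Finset (Finset (Fin n))}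
    (hL : L ⊆ M.P Finset.univ) (σ : M.Full N) (b : ℝ) (hpos : 0 < (∑ J ∈ L, M.a J) * N) :
    Pr.map (en X L σ) ≤ ENNReal.ofReal (gaussConst b ((∑ J ∈ L, M.a J) * N)) • expWeight b := by
  rw [map_en hX hm hL]
  exact gaussianReal_le_expWeight b hpos

end

/-! ### Level energies and their centering -/

section levels

lemma level_subset (l : ℕ) : M.level l ⊆ M.P Finset.univ :=
  Finset.sdiff_subset.trans (M.P_mono (Finset.subset_univ _))

lemma sum_level (l : ℕ) : ∑ J ∈ M.level l, M.a J = M.Delta l :=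
  (M.alpha_sub (M.chain_mono (Nat.sub_le l 1))).symm

lemma mem_level {l : ℕ} {J : Finset (Fin n)} :
    J ∈ M.level l ↔ (J ⊆ M.chain l ∧ 0 < M.a J) ∧ ¬ J ⊆ M.chain (l - 1) := by
  rw [level, Finset.mem_sdiff, mem_P, mem_P]
  tauto

variable (X : (J : Finset (Fin n)) → M.Conf N J → Ω → ℝ)

/-- The centered energy of level `l`. -/
def lev (l : ℕ) (σ : M.Full N) (ω : Ω) : ℝ := en X (M.level l) σ ω - M.aN N l

/-- The σ-algebra of the variables of the first `l` levels. -/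
abbrev past (l : ℕ) : MeasurableSpace Ω := sig X {p : M.Site N | p.1.1 ∈ M.P (M.chain l)}

variable {X}

lemma past_mono : Monotone (past X) := fun _ _ h =>
  sig_mono fun _ hp => M.P_mono (M.chain_mono h) hp

lemma sites_level_subset (l : ℕ) (σ : M.Full N) :
    sites (M.level l) σ ⊆ {p | p.1.1 ∈ M.P (M.chain l)} := fun _ hp =>
  (Finset.mem_sdiff.1 hp.1).1

lemma measurable_lev (l : ℕ) (σ : M.Full N) : Measurable[past X l] (lev X l σ) :=
  Measurable.sub_const (measurable_en (level_subset l) (sites_level_subset l σ)) _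

variable [m : MeasurableSpace Ω] {Pr : Measure Ω}

lemma indep_past (hX : M.IsDisorder Pr X) (hm : ∀ J τ, Measurable (X J τ)) (l : ℕ) :
    Indep (past X l) (sig X {p : M.Site N | p.1.1 ∈ M.level (l + 1)}) Pr := by
  refine indep_sig hX hm (Set.disjoint_left.2 fun p h1 h2 => ?_)
  exact (Finset.mem_sdiff.1 h2).2 h1

/-- The logarithmic term of `aN` becomes the factor `√N`, which in `map_lev_le` cancels the `1 / √N`
of the gaussian density. -/
lemma exp_neg_beta_aN {l : ℕ} (hβ : 0 < M.beta l) (hΔ : 0 < M.Delta l) (hN : 0 < N) :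
    Real.exp (-M.beta l * M.aN N l) =
      Real.exp (-(M.beta l ^ 2 * M.Delta l * N)) * √N / (M.beta l * √(2 * Real.pi * M.Delta l)) := by
  have hN' : (0 : ℝ) < N := by exact_mod_cast hN
  have h1 : 0 < M.beta l * √(2 * Real.pi * M.Delta l) := by positivity
  have : -M.beta l * M.aN N l = -(M.beta l ^ 2 * M.Delta l * N) + Real.log (√N) -
      Real.log (M.beta l * √(2 * Real.pi * M.Delta l)) := by
    rw [aN, Real.log_sqrt hN'.le]
    field_simp
    ring
  rw [this, Real.exp_sub, Real.exp_add, Real.exp_log (by positivity), Real.exp_log h1]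

variable [IsProbabilityMeasure Pr]

lemma map_lev_le (hX : M.IsDisorder Pr X) (hm : ∀ J τ, Measurable (X J τ)) {l : ℕ}
    (hβ : 0 < M.beta l) (hΔ : 0 < M.Delta l) (hN : 0 < N) (σ : M.Full N) :
    Pr.map (lev X l σ) ≤ ENNReal.ofReal (Real.exp (-(M.beta l ^ 2 * M.Delta l * N / 2)) *
      (2 * Real.pi * M.beta l * M.Delta l)⁻¹) • expWeight (M.beta l) := by
  have hN' : (0 : ℝ) < N := by exact_mod_cast hN
  refine Measure.le_iff.2 fun E hE => ?_
  have h1 := map_en_le hX hm (level_subset l) σ (M.beta l)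
    (by rw [sum_level]; positivity) {x | -M.aN N l + x ∈ E}
  rw [Measure.map_apply (measurable_en' hm _ σ) (measurableSet_add_mem _ hE)] at h1
  have hm' : Measurable (lev X l σ) := (measurable_en' hm _ σ).sub_const _
  rw [Measure.map_apply hm' hE]
  have h2 : lev X l σ ⁻¹' E = en X (M.level l) σ ⁻¹' {x | -M.aN N l + x ∈ E} := by
    ext ω
    simp only [Set.mem_preimage, Set.mem_ofPred_eq, lev]
    rw [neg_add_eq_sub]
  rw [h2]
  refine h1.trans_eq ?_
  rw [Measure.smul_apply, smul_eq_mul, expWeight_preimage_add _ _ hE, ← mul_assoc,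
    ← ENNReal.ofReal_mul (gaussConst_nonneg _ _), Measure.smul_apply, smul_eq_mul]
  congr 2
  rw [show M.beta l * -M.aN N l = -M.beta l * M.aN N l by ring, exp_neg_beta_aN hβ hΔ hN, sum_level,
    gaussConst, ← mul_assoc (2 * Real.pi), Real.sqrt_mul (by positivity)]
  have e : Real.exp (-(M.beta l ^ 2 * M.Delta l * N / 2)) =
      Real.exp (M.beta l ^ 2 * (M.Delta l * N) / 2) * Real.exp (-(M.beta l ^ 2 * M.Delta l * N)) := by
    rw [← Real.exp_add]; ring_nf
  rw [e]
  have h3 : √(2 * Real.pi * M.Delta l) * √(2 * Real.pi * M.Delta l) = 2 * Real.pi * M.Delta l :=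
    Real.mul_self_sqrt (by positivity)
  have h4 : 0 < √(2 * Real.pi * M.Delta l) := by positivity
  have h5 : 0 < √(N : ℝ) := by positivity
  set s := √(2 * Real.pi * M.Delta l)
  rw [show 2 * Real.pi * M.beta l * M.Delta l = M.beta l * (s * s) by rw [h3]; ring]
  field_simp

end levels

end GREM

/-! ### Numbers of configurations and first moments of partial energies -/

namespace GREM

variable {n : ℕ} {M : GREM n} {N : ℕ}

/-- The nominal number `2 ^ (γ(A) N)` of configurations on `A`. -/
def cap (M : GREM n) (N : ℕ) (A : Finset (Fin n)) : ℝ := Real.exp (Real.log 2 * M.gam A * N)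

lemma card_Conf_le (A : Finset (Fin n)) : (Fintype.card (M.Conf N A) : ℝ) ≤ M.cap N A := by
  rw [Fintype.card_pi]
  simp only [Fintype.card_fin]
  rw [Finset.prod_coe_sort A (fun i => M.size N i), cap, gam, Finset.mul_sum, Finset.sum_mul,
    Real.exp_sum]
  push_cast
  refine Finset.prod_le_prod (fun i _ => Nat.cast_nonneg _) fun i _ => ?_
  refine (Nat.floor_le (by positivity)).trans_eq ?_
  rw [Real.rpow_def_of_pos two_pos]
  ring_nf

lemma card_Conf_le_ofReal (A : Finset (Fin n)) :
    (Fintype.card (M.Conf N A) : ENNReal) ≤ ENNReal.ofReal (M.cap N A) := by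
  rw [← ENNReal.ofReal_natCast]
  exact ENNReal.ofReal_le_ofReal (card_Conf_le A)

lemma cap_pos (A : Finset (Fin n)) : 0 < M.cap N A := Real.exp_pos _

lemma beta_nonneg (l : ℕ) : 0 ≤ M.beta l := by
  cases l with
  | zero => exact le_rfl
  | succ l => exact Real.sInf_nonneg (by rintro _ ⟨A, -, rfl⟩; exact Real.sqrt_nonneg _)

lemma Delta_nonneg (l : ℕ) : 0 ≤ M.Delta l :=
  sub_nonneg.2 (M.alpha_mono (M.chain_mono (Nat.sub_le l 1)))

/-- The constant in the exponential domination of the law of `lev X l σ`. -/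
def levConst (M : GREM n) (l : ℕ) : ℝ := (2 * Real.pi * M.beta l * M.Delta l)⁻¹

lemma levConst_nonneg (l : ℕ) : 0 ≤ M.levConst l := by
  have := M.beta_nonneg l
  have := M.Delta_nonneg l
  have := Real.pi_pos
  unfold levConst
  positivity

/-- The constant in the bound of the probability of a window of the level `l`. -/
def winConst (M : GREM n) (C : ℝ) (l : ℕ) : ℝ :=
  M.levConst l * (Real.exp (M.beta l * C) * (2 * C))

lemma winConst_nonneg {C : ℝ} (hC : 0 ≤ C) (l : ℕ) : 0 ≤ M.winConst C l :=
  mul_nonneg (levConst_nonneg l) (by positivity)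

/-- The inverse of the number of configurations of level `l`. -/
def levWeight (M : GREM n) (N l : ℕ) : ℝ := Real.exp (-(M.beta l ^ 2 * M.Delta l * N / 2))

lemma levWeight_pos (l : ℕ) : 0 < M.levWeight N l := Real.exp_pos _

section
variable (hcover : ∀ i : Fin n, ∃ J ∈ M.P Finset.univ, i ∈ J)

-- This is `beta_sq_mul_Delta` exponentiated: one weight removes exactly one level from the count.
-- Telescoping it cancels the exponentials in `N`.
include hcover in
lemma levWeight_mul_cap {l : ℕ} (hl : 1 ≤ l) (hK : l ≤ M.K) :
    M.levWeight N l * M.cap N (M.chain l) = M.cap N (M.chain (l - 1)) := by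
  rw [levWeight, M.beta_sq_mul_Delta hcover hl hK, cap, cap, ← Real.exp_add]
  ring_nf

include hcover in
lemma prod_levWeight_mul_cap {r l : ℕ} (hrl : r ≤ l) (hK : l ≤ M.K) :
    (∏ i ∈ Finset.Icc (r + 1) l, M.levWeight N i) * M.cap N (M.chain l) =
      M.cap N (M.chain r) := by
  induction l, hrl using Nat.le_induction with
  | base => simp
  | succ l hl ih =>
    rw [Finset.prod_Icc_succ_top (by omega), mul_assoc, levWeight_mul_cap hcover (by omega) hK,
      Nat.add_sub_cancel, ih (by omega)]

end

lemma cap_chain_zero : M.cap N (M.chain 0) = 1 := by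
  simp [cap, chain, gam]

variable {Ω : Type*} {X : (J : Finset (Fin n)) → M.Conf N J → Ω → ℝ}

/-- The sum of the centered energies of the levels `1, …, l`. -/
def part (X : (J : Finset (Fin n)) → M.Conf N J → Ω → ℝ) (l : ℕ) (σ : M.Full N) (ω : Ω) : ℝ :=
  ∑ q ∈ Finset.Icc 1 l, lev X q σ ω

lemma lev_congr {l q : ℕ} (hq : q ≤ l) {σ τ : M.Full N}
    (h : (M.chain l).restrict σ = (M.chain l).restrict τ) : lev X q σ = lev X q τ := by
  funext ω
  have : en X (M.level q) σ = en X (M.level q) τ := en_congr fun J hJ i hi =>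
    congrFun h ⟨i, M.chain_mono hq (M.subset_of_mem_level hJ hi)⟩
  rw [lev, lev, this]

lemma part_congr {l q : ℕ} (hq : q ≤ l) {σ τ : M.Full N}
    (h : (M.chain l).restrict σ = (M.chain l).restrict τ) : part X q σ = part X q τ := by
  funext ω
  exact Finset.sum_congr rfl fun i hi =>
    congrFun (lev_congr ((Finset.mem_Icc.1 hi).2.trans hq) h) ω

lemma part_sub {l : ℕ} (hl : 1 ≤ l) (σ : M.Full N) (ω : Ω) :
    lev X l σ ω = part X l σ ω - part X (l - 1) σ ω := by
  obtain ⟨l, rfl⟩ := Nat.exists_eq_add_of_le' hl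
  rw [part, Finset.sum_Icc_succ_top (by omega), Nat.add_sub_cancel, part]
  ring

variable [m : MeasurableSpace Ω] {Pr : Measure Ω} [IsProbabilityMeasure Pr]

omit [IsProbabilityMeasure Pr] in
lemma measurable_lev' (hm : ∀ J τ, Measurable (X J τ)) (l : ℕ) (σ : M.Full N) :
    Measurable (lev X l σ) :=
  (measurable_en' hm _ σ).sub_const _

section
variable (hcover : ∀ i : Fin n, ∃ J ∈ M.P Finset.univ, i ∈ J)
  (hX : M.IsDisorder Pr X) (hm : ∀ J τ, Measurable (X J τ)) (hN : 0 < N)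
include hcover hX hm hN

lemma measure_lev_le {l : ℕ} (hl : 1 ≤ l) (hK : l ≤ M.K) (C : ℝ) (σ : M.Full N) :
    Pr {ω | lev X l σ ω ∈ Set.Icc (-C) C} ≤ ENNReal.ofReal (M.levWeight N l * M.winConst C l) := by
  have hβ := M.beta_pos hcover hl hK
  have h := map_lev_le hX hm hβ (M.Delta_pos hcover hl hK) hN σ (Set.Icc (-C) C)
  rw [Measure.map_apply (measurable_lev' hm l σ) measurableSet_Icc] at h
  refine h.trans ?_
  have h0 := M.levConst_nonneg l
  have h1 := M.levWeight_pos (N := N) l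
  rw [winConst, Measure.smul_apply, smul_eq_mul, ← mul_assoc, ENNReal.ofReal_mul (p := _ * _)
    (by positivity)]
  gcongr
  · exact le_rfl
  · exact le_rfl
  · refine (expWeight_Icc_le hβ.le _ _).trans_eq ?_
    ring_nf

/-- The `cap (A_l)` configurations are exactly compensated by the weights of levels `1, …, l`. The
bound is free of `N`, so thresholds can be fixed before `N`. -/
lemma measure_part_le {l : ℕ} (hl : 1 ≤ l) (hK : l ≤ M.K) (t : ℕ → ℝ) {E : Set ℝ}
    (hE : MeasurableSet E) :
    Pr {ω | ∃ σ : M.Full N, (∀ i ∈ Finset.Ico 1 l, part X i σ ω ≤ t i) ∧ part X l σ ω ∈ E} ≤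
      ENNReal.ofReal ((∏ i ∈ Finset.Icc 1 l, M.levConst i) * ∏ i ∈ Finset.Ico 1 l,
        (Real.exp ((M.beta (i + 1) - M.beta i) * t i) / (M.beta (i + 1) - M.beta i))) *
        expWeight (M.beta l) E := by
  have h0 : 0 ≤ ∏ i ∈ Finset.Icc 1 l, M.levConst i :=
    Finset.prod_nonneg fun i _ => M.levConst_nonneg i
  have key := measure_exists_le_card_mul (Pr := Pr)
    (fun σ : M.Full N => {ω | (∀ i ∈ Finset.Ico 1 l, part X i σ ω ≤ t i) ∧ part X l σ ω ∈ E})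
    (fun σ => (M.chain l).restrict σ) (fun σ τ h => by
      ext ω
      simp only [Set.mem_ofPred_eq]
      rw [part_congr le_rfl h]
      refine and_congr_left fun _ => forall₂_congr fun i hi => ?_
      rw [part_congr (Finset.mem_Ico.1 hi).2.le h])
    (fun σ => measure_partialSums_le (V := fun l => lev X l σ) (𝓖 := past X)
      (fun l => sig_le hm _) past_mono (fun l => measurable_lev l σ)
      (fun l => indep_of_indep_of_le_right (indep_past hX hm l)
        (Measurable.comap_le (Measurable.sub_const
          (measurable_en (level_subset _) fun p hp => hp.1) _)))
      (c := fun l => M.levWeight N l * M.levConst l) (b := M.beta) t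
      (fun l => mul_nonneg (levWeight_pos l).le (levConst_nonneg l))
      (fun l hl hK => map_lev_le hX hm (M.beta_pos hcover hl hK) (M.Delta_pos hcover hl hK) hN σ)
      (fun l hl hK => M.beta_lt hcover hl hK) hl hK hE)
  refine key.trans ?_
  rw [← mul_assoc]
  gcongr
  refine (mul_le_mul_left (card_Conf_le_ofReal _) _).trans ?_
  rw [← ENNReal.ofReal_mul (cap_pos _).le]
  refine ENNReal.ofReal_le_ofReal (le_of_eq ?_)
  have := prod_levWeight_mul_cap (N := N) hcover (Nat.zero_le l) hK
  rw [cap_chain_zero, zero_add] at this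
  rw [Finset.prod_mul_distrib]
  linear_combination (∏ i ∈ Finset.Icc 1 l, M.levConst i) * (∏ i ∈ Finset.Ico 1 l,
        (Real.exp ((M.beta (i + 1) - M.beta i) * t i) / (M.beta (i + 1) - M.beta i))) * this

end

section
variable (hcover : ∀ i : Fin n, ∃ J ∈ M.P Finset.univ, i ∈ J) {j : ℕ} (hjK : j ≤ M.K)
include hcover hjK

-- The increments of `β` telescope, and each summand is a constant times `exp ((β_l - β_1) T - β_l
-- T) = exp (-β_1 T)`.
omit m [IsProbabilityMeasure Pr] in
lemma exists_upper_threshold {ε : ℝ} (hε : 0 < ε) : ∃ T, 0 ≤ T ∧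
    ∑ l ∈ Finset.Icc 1 j, (∏ i ∈ Finset.Icc 1 l, M.levConst i) * (∏ i ∈ Finset.Ico 1 l,
      (Real.exp ((M.beta (i + 1) - M.beta i) * T) / (M.beta (i + 1) - M.beta i))) *
      (Real.exp (-M.beta l * T) / M.beta l) < ε := by
  have h : Tendsto (fun T => ∑ l ∈ Finset.Icc 1 j, (∏ i ∈ Finset.Icc 1 l, M.levConst i) *
      (∏ i ∈ Finset.Ico 1 l,
      (Real.exp ((M.beta (i + 1) - M.beta i) * T) / (M.beta (i + 1) - M.beta i))) *
      (Real.exp (-M.beta l * T) / M.beta l)) atTop (nhds 0) := by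
    rw [← Finset.sum_const_zero (s := Finset.Icc 1 j)]
    refine tendsto_finsetSum _ fun l hl => ?_
    obtain ⟨hl, hlj⟩ := Finset.mem_Icc.1 hl
    have hβ := M.beta_pos hcover le_rfl (show 1 ≤ M.K by omega)
    have : ∀ T, (∏ i ∈ Finset.Icc 1 l, M.levConst i) * (∏ i ∈ Finset.Ico 1 l,
        (Real.exp ((M.beta (i + 1) - M.beta i) * T) / (M.beta (i + 1) - M.beta i))) *
        (Real.exp (-M.beta l * T) / M.beta l) =
        (∏ i ∈ Finset.Icc 1 l, M.levConst i) * (∏ i ∈ Finset.Ico 1 l,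
        (M.beta (i + 1) - M.beta i)⁻¹) * (M.beta l)⁻¹ * Real.exp (-(M.beta 1 * T)) := by
      intro T
      have e : ∏ i ∈ Finset.Ico 1 l, Real.exp ((M.beta (i + 1) - M.beta i) * T) =
          Real.exp ((M.beta l - M.beta 1) * T) := by
        rw [← Real.exp_sum, ← Finset.sum_mul, Finset.sum_Ico_sub _ hl]
      simp only [div_eq_mul_inv]
      rw [Finset.prod_mul_distrib, e, show -(M.beta 1 * T) = (M.beta l - M.beta 1) * T +
        -M.beta l * T by ring, Real.exp_add]
      ring
    simp only [this]
    rw [← mul_zero ((∏ i ∈ Finset.Icc 1 l, M.levConst i) * (∏ i ∈ Finset.Ico 1 l,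
        (M.beta (i + 1) - M.beta i)⁻¹) * (M.beta l)⁻¹)]
    exact (Real.tendsto_exp_neg_atTop_nhds_zero.comp
      (tendsto_id.const_mul_atTop hβ)).const_mul _
  obtain ⟨T, h1, h2⟩ := ((h.eventually_lt_const hε).and (eventually_ge_atTop 0)).exists
  exact ⟨T, h2, h1⟩

-- Lowering the threshold of one level `l` to `-L` introduces the factor `exp (-(β_{l+1} - β_l) L)`,
-- which tends to 0 since `β` increases strictly.
omit m [IsProbabilityMeasure Pr] in
lemma exists_lower_threshold (T R : ℝ) {ε : ℝ} (hε : 0 < ε) : ∃ L, 0 ≤ L ∧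
    ∑ l ∈ Finset.Ico 1 j, (∏ i ∈ Finset.Icc 1 j, M.levConst i) * (∏ i ∈ Finset.Ico 1 j,
      (Real.exp ((M.beta (i + 1) - M.beta i) * Function.update (fun _ => T) l (-L) i) /
        (M.beta (i + 1) - M.beta i))) * R < ε := by
  have h : Tendsto (fun L => ∑ l ∈ Finset.Ico 1 j, (∏ i ∈ Finset.Icc 1 j, M.levConst i) *
      (∏ i ∈ Finset.Ico 1 j,
      (Real.exp ((M.beta (i + 1) - M.beta i) * Function.update (fun _ => T) l (-L) i) /
        (M.beta (i + 1) - M.beta i))) * R) atTop (nhds 0) := by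
    rw [← Finset.sum_const_zero (s := Finset.Ico 1 j)]
    refine tendsto_finsetSum _ fun l hl => ?_
    obtain ⟨h1, h2⟩ := Finset.mem_Ico.1 hl
    have hd : 0 < M.beta (l + 1) - M.beta l := sub_pos.2 (M.beta_lt hcover h1 (by omega))
    have h3 : Tendsto (fun L : ℝ => ∏ i ∈ Finset.Ico 1 j,
        (Real.exp ((M.beta (i + 1) - M.beta i) * Function.update (fun _ => T) l (-L) i) /
        (M.beta (i + 1) - M.beta i))) atTop (nhds (∏ i ∈ Finset.Ico 1 j, if i = l then 0 else
        (Real.exp ((M.beta (i + 1) - M.beta i) * T) / (M.beta (i + 1) - M.beta i)))) := by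
      refine tendsto_finsetProd _ fun i _ => ?_
      rcases eq_or_ne i l with rfl | hne
      · simp only [Function.update_self, if_true, mul_neg]
        rw [← zero_div (M.beta (i + 1) - M.beta i)]
        exact (Real.tendsto_exp_neg_atTop_nhds_zero.comp
          (tendsto_id.const_mul_atTop hd)).div_const _
      · simp only [Function.update_of_ne hne, if_neg hne]
        exact tendsto_const_nhds
    rw [Finset.prod_eq_zero hl (by simp)] at h3
    simpa using (h3.const_mul (∏ i ∈ Finset.Icc 1 j, M.levConst i)).mul_const R
  obtain ⟨L, h1, h2⟩ := ((h.eventually_lt_const hε).and (eventually_ge_atTop 0)).exists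
  exact ⟨L, h2, h1⟩

end

end GREM

/-! ### Localisation of all levels in a fixed window -/

namespace GREM

variable {n : ℕ} {M : GREM n}

/-- Outside the window, either some partial sum is the first to exceed `T`, or all stay below `T`
and one before `j` falls below `-L`. Both events have small expected counts, uniformly in `N`. -/
lemma exists_window (hcover : ∀ i : Fin n, ∃ J ∈ M.P Finset.univ, i ∈ J) {j : ℕ} (hj : 1 ≤ j)
    (hjK : j ≤ M.K) {R : ℝ} (hR : 0 ≤ R) {ε : ℝ} (hε : 0 < ε) :
    ∃ C, 0 ≤ C ∧ ∀ {N : ℕ}, 0 < N → ∀ {Ω : Type*} [MeasurableSpace Ω] {Pr : Measure Ω}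
      [IsProbabilityMeasure Pr] {X : (J : Finset (Fin n)) → M.Conf N J → Ω → ℝ},
      M.IsDisorder Pr X → (∀ J τ, Measurable (X J τ)) →
      Pr {ω | ∃ σ : M.Full N, part X j σ ω ∈ Set.Icc (-R) R ∧
        ∃ l ∈ Finset.Icc 1 j, lev X l σ ω ∉ Set.Icc (-C) C} ≤ ENNReal.ofReal ε := by
  obtain ⟨T, hT, hTε⟩ := exists_upper_threshold hcover hjK (half_pos hε)
  obtain ⟨L, hL, hLε⟩ := exists_lower_threshold hcover hjK T
    (Real.exp (M.beta j * R) * (2 * R)) (half_pos hε)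
  -- A level energy is a difference of two consecutive partial sums, each lying in `[-(L + R), T +
  -- R]`; the partial sum of index 0 is 0.
  refine ⟨L + T + 2 * R, by positivity, ?_⟩
  intro N hN Ω _ Pr _ X hX hm
  have hd : ∀ i, 1 ≤ i → i + 1 ≤ j → 0 ≤ M.beta (i + 1) - M.beta i := fun i h1 h2 =>
    sub_nonneg.2 (M.beta_lt hcover h1 (by omega)).le
  have hprod : ∀ l ≤ j, ∀ t : ℕ → ℝ, 0 ≤ (∏ i ∈ Finset.Icc 1 l, M.levConst i) *
      ∏ i ∈ Finset.Ico 1 l,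
        (Real.exp ((M.beta (i + 1) - M.beta i) * t i) / (M.beta (i + 1) - M.beta i)) := by
    intro l hl t
    refine mul_nonneg (Finset.prod_nonneg fun i _ => M.levConst_nonneg i)
      (Finset.prod_nonneg fun i hi => div_nonneg (Real.exp_pos _).le ?_)
    have := Finset.mem_Ico.1 hi
    exact hd i (by omega) (by omega)
  let U : ℕ → Set Ω := fun l => {ω | ∃ σ : M.Full N,
    (∀ i ∈ Finset.Ico 1 l, part X i σ ω ≤ T) ∧ part X l σ ω ∈ Set.Ici T}
  let D : ℕ → Set Ω := fun l => {ω | ∃ σ : M.Full N,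
    (∀ i ∈ Finset.Ico 1 j, part X i σ ω ≤ Function.update (fun _ => T) l (-L) i) ∧
      part X j σ ω ∈ Set.Icc (-R) R}
  have hsub : {ω | ∃ σ : M.Full N, part X j σ ω ∈ Set.Icc (-R) R ∧
      ∃ l ∈ Finset.Icc 1 j, lev X l σ ω ∉ Set.Icc (-(L + T + 2 * R)) (L + T + 2 * R)} ⊆
      (⋃ l ∈ Finset.Icc 1 j, U l) ∪ ⋃ l ∈ Finset.Ico 1 j, D l := by
    rintro ω ⟨σ, hσ, l, hl, hlev⟩
    by_contra hcon
    simp only [Set.mem_union, Set.mem_iUnion, not_or, not_exists] at hcon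
    -- Strong induction singles out the first exceedance, as `U i` requires all earlier partial sums
    -- to be at most `T`.
    have hup : ∀ i, 1 ≤ i → i ≤ j → part X i σ ω ≤ T := by
      intro i
      induction i using Nat.strong_induction_on with
      | _ i ih =>
        intro h1 h2
        by_contra hlt
        refine hcon.1 i (Finset.mem_Icc.2 ⟨h1, h2⟩) ⟨σ, fun q hq => ?_, (not_le.1 hlt).le⟩
        have := Finset.mem_Ico.1 hq
        exact ih q this.2 this.1 (by omega)
    have hlow : ∀ i, 1 ≤ i → i < j → -L ≤ part X i σ ω := by
      intro i h1 h2
      by_contra hlt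
      refine hcon.2 i (Finset.mem_Ico.2 ⟨h1, h2⟩) ⟨σ, fun q hq => ?_, hσ⟩
      have := Finset.mem_Ico.1 hq
      rcases eq_or_ne q i with rfl | hne
      · rw [Function.update_self]
        exact (not_le.1 hlt).le
      · rw [Function.update_of_ne hne]
        exact hup q this.1 this.2.le
    have hb : ∀ i ≤ j, part X i σ ω ∈ Set.Icc (-(L + R)) (T + R) := by
      intro i hi
      rcases Nat.eq_zero_or_pos i with rfl | h1
      · simp only [part, Finset.Icc_eq_empty_of_lt zero_lt_one, Finset.sum_empty]
        constructor <;> linarith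
      · rcases hi.eq_or_lt with rfl | h2
        · exact ⟨by linarith [hσ.1], by linarith [hσ.2]⟩
        · exact ⟨by linarith [hlow i h1 h2], by linarith [hup i h1 hi]⟩
    obtain ⟨hl1, hlj⟩ := Finset.mem_Icc.1 hl
    have h1 := hb l hlj
    have h2 := hb (l - 1) (by omega)
    rw [part_sub hl1] at hlev
    exact hlev ⟨by linarith [h1.1, h2.2], by linarith [h1.2, h2.1]⟩
  refine (measure_mono hsub).trans ((measure_union_le _ _).trans ?_)
  rw [← add_halves ε, ENNReal.ofReal_add (half_pos hε).le (half_pos hε).le]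
  gcongr
  · refine (measure_biUnion_finset_le _ _).trans (le_trans ?_ (ENNReal.ofReal_le_ofReal hTε.le))
    rw [ENNReal.ofReal_sum_of_nonneg]
    · refine Finset.sum_le_sum fun l hl => ?_
      obtain ⟨hl1, hlj⟩ := Finset.mem_Icc.1 hl
      refine (measure_part_le hcover hX hm hN hl1 (by omega) (fun _ => T)
        measurableSet_Ici).trans_eq ?_
      rw [expWeight_Ici (M.beta_pos hcover hl1 (by omega)),
        ← ENNReal.ofReal_mul (hprod l hlj fun _ => T)]
    · intro l hl
      exact mul_nonneg (hprod l (Finset.mem_Icc.1 hl).2 fun _ => T)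
        (div_nonneg (Real.exp_pos _).le (beta_nonneg l))
  · refine (measure_biUnion_finset_le _ _).trans (le_trans ?_ (ENNReal.ofReal_le_ofReal hLε.le))
    rw [ENNReal.ofReal_sum_of_nonneg]
    · refine Finset.sum_le_sum fun l hl => ?_
      refine (measure_part_le hcover hX hm hN hj hjK _ measurableSet_Icc).trans ?_
      rw [ENNReal.ofReal_mul (hprod j le_rfl _)]
      gcongr
      refine (expWeight_Icc_le (beta_nonneg j) _ _).trans_eq ?_
      ring_nf
    · intro l hl
      exact mul_nonneg (hprod j le_rfl _) (by positivity)

end GREM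

/-! ### Overlap sets, and windows of couples below the level of overlap -/

namespace GREM

variable {n : ℕ} {M : GREM n}

/-- `S` is the set on which two configurations of `A_k` agree, when they agree exactly on `A_r`
among the sites of `A_{k-1}`, and at some but not all of the sites of `A_k \ A_{k-1}` if
`r = k - 1`. -/
structure IsOverlap (M : GREM n) (k r : ℕ) (S : Finset (Fin n)) : Prop where
  lt : r < k
  subset : S ⊆ M.chain k
  inter : S ∩ M.chain (k - 1) = M.chain r
  nonempty : (S \ M.chain (k - 1)).Nonempty
  ne : S ≠ M.chain k

open Classical in
/-- The sets of level `k` contained in `S`. -/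
def shared (M : GREM n) (k : ℕ) (S : Finset (Fin n)) : Finset (Finset (Fin n)) :=
  (M.level k).filter (· ⊆ S)

open Classical in
/-- The sets of level `k` not contained in `S`. -/
def unshared (M : GREM n) (k : ℕ) (S : Finset (Fin n)) : Finset (Finset (Fin n)) :=
  (M.level k).filter (¬ · ⊆ S)

section deterministic
variable {k r : ℕ} {S : Finset (Fin n)}

lemma shared_union_unshared : M.shared k S ∪ M.unshared k S = M.level k :=
  Finset.filter_union_filter_not_eq _ _

lemma disjoint_shared_unshared : Disjoint (M.shared k S) (M.unshared k S) :=
  Finset.disjoint_filter_filter_not _ _ _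

lemma shared_subset : M.shared k S ⊆ M.level k := Finset.filter_subset _ _

lemma unshared_subset : M.unshared k S ⊆ M.level k := Finset.filter_subset _ _

lemma sum_shared_add_sum_unshared :
    ∑ J ∈ M.shared k S, M.a J + ∑ J ∈ M.unshared k S, M.a J = M.Delta k := by
  rw [← Finset.sum_union disjoint_shared_unshared, shared_union_unshared, sum_level]

lemma level_pos {J : Finset (Fin n)} (h : J ∈ M.level k) : 0 < M.a J := (mem_level.1 h).1.2

lemma sum_pos_of_nonempty {L : Finset (Finset (Fin n))} (hL : L ⊆ M.level k) (h : L.Nonempty) :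
    0 < ∑ J ∈ L, M.a J :=
  Finset.sum_pos (fun _ hJ => level_pos (hL hJ)) h

namespace IsOverlap

variable (hcover : ∀ i : Fin n, ∃ J ∈ M.P Finset.univ, i ∈ J) (h : M.IsOverlap k r S)
include h

lemma one_le : 1 ≤ k := by have := h.lt; omega

lemma cap_overlap (N : ℕ) : M.cap N S = M.cap N (M.chain r) * M.cap N (S \ M.chain (k - 1)) := by
  have : M.gam S = M.gam (M.chain r) + M.gam (S \ M.chain (k - 1)) := by
    rw [← h.inter, gam, gam, gam, Finset.sum_inter_add_sum_sdiff]
  rw [cap, cap, cap, ← Real.exp_add, this]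
  ring_nf

lemma cap_sdiff (N : ℕ) : M.cap N (M.chain k \ S) * M.cap N S = M.cap N (M.chain k) := by
  rw [cap, cap, cap, ← Real.exp_add, ← M.gam_sub h.subset]
  ring_nf

include hcover

/-- Minimality of `β_k` tested on `S ∪ A_{k-1}`, whose variance beyond `A_{k-1}` includes all shared
sets. -/
lemma beta_sq_mul_shared_le (hK : k ≤ M.K) :
    M.beta k ^ 2 * ∑ J ∈ M.shared k S, M.a J ≤
      2 * Real.log 2 * M.gam (S \ M.chain (k - 1)) := by
  have h1 := M.excess_beta_nonneg hcover h.one_le hK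
    (Finset.subset_union_right (s₁ := S) (s₂ := M.chain (k - 1)))
  rw [excess, M.gam_sub Finset.subset_union_right, M.alpha_sub Finset.subset_union_right,
    Finset.union_sdiff_right] at h1
  have h2 : M.shared k S ⊆ M.P (S ∪ M.chain (k - 1)) \ M.P (M.chain (k - 1)) := by
    intro J hJ
    have hJ' := Finset.mem_filter.1 hJ
    refine Finset.mem_sdiff.2 ⟨M.mem_P.2 ⟨hJ'.2.trans Finset.subset_union_left, level_pos hJ'.1⟩,
      (Finset.mem_sdiff.1 hJ'.1).2⟩
  have h3 : ∑ J ∈ M.shared k S, M.a J ≤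
      ∑ J ∈ M.P (S ∪ M.chain (k - 1)) \ M.P (M.chain (k - 1)), M.a J :=
    Finset.sum_le_sum_of_subset_of_nonneg h2 fun J _ _ => M.a_nonneg J
  have h4 := mul_le_mul_of_nonneg_left h3 (sq_nonneg (M.beta k))
  linarith

/-- Suppose that every set of level `k` lies in `S`. If `r < k - 1`, the site `s ∈ A_{k-1} \
A_{k-2}` of `CondC'` would be in `S ∩ A_{k-1} = A_r ⊆ A_{k-2}`. If `r = k - 1`, then `S ⊊ A_k` would
carry the whole of `Δ_k` with fewer sites, against the minimality of `β_k`. -/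
lemma unshared_nonempty (hirr : M.CondC') (hK : k ≤ M.K) : (M.unshared k S).Nonempty := by
  by_contra hne
  have hall : ∀ J ∈ M.level k, J ⊆ S := by
    intro J hJ
    by_contra hJS
    exact hne ⟨J, Finset.mem_filter.2 ⟨hJ, hJS⟩⟩
  have hlt := h.lt
  rcases Nat.lt_or_ge (r + 1) k with hr | hr
  · obtain ⟨s, hs, J, hJ, hsJ⟩ := hirr k (by omega) hK
    obtain ⟨hs1, hs2⟩ := Finset.mem_sdiff.1 hs
    have h1 : s ∈ S ∩ M.chain (k - 1) := Finset.mem_inter.2 ⟨hall J hJ hsJ, hs1⟩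
    rw [h.inter] at h1
    exact hs2 (M.chain_mono (by omega) h1)
  · have hr' : r = k - 1 := by omega
    have h0 := h.inter
    rw [hr', Finset.inter_eq_right] at h0
    have h1 := h.beta_sq_mul_shared_le hcover hK
    have h2 := sum_shared_add_sum_unshared (M := M) (k := k) (S := S)
    rw [Finset.not_nonempty_iff_eq_empty.1 hne, Finset.sum_empty, add_zero] at h2
    rw [h2, M.beta_sq_mul_Delta hcover h.one_le hK, ← M.gam_sub h0] at h1
    have h3 := M.gam_lt (Finset.ssubset_iff_subset_ne.2 ⟨h.subset, h.ne⟩)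
    have h4 := log_two_pos
    have h5 := le_of_mul_le_mul_left h1 (by positivity)
    linarith

end IsOverlap

end deterministic

section windows
variable {N : ℕ} {Ω : Type*} {X : (J : Finset (Fin n)) → M.Conf N J → Ω → ℝ}

lemma measurableSet_lev_mem {l q : ℕ} (hq : q ≤ l) (C : ℝ) (σ : M.Full N) :
    MeasurableSet[past X l] {ω | lev X q σ ω ∈ Set.Icc (-C) C} :=
  ((measurable_lev q σ).mono (past_mono hq) le_rfl) measurableSet_Icc

lemma measurableSet_windows (l : ℕ) (C : ℝ) (σ : M.Full N) :
    MeasurableSet[past X l] {ω | ∀ i ∈ Finset.Icc 1 l, lev X i σ ω ∈ Set.Icc (-C) C} := by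
  have : {ω | ∀ i ∈ Finset.Icc 1 l, lev X i σ ω ∈ Set.Icc (-C) C} =
      ⋂ i ∈ Finset.Icc 1 l, {ω | lev X i σ ω ∈ Set.Icc (-C) C} := by
    ext ω; simp
  rw [this]
  exact Finset.measurableSet_biInter _ fun i hi =>
    measurableSet_lev_mem (Finset.mem_Icc.1 hi).2 C σ

lemma measurableSet_pair_windows (l : ℕ) (C : ℝ) (σ τ : M.Full N) :
    MeasurableSet[past X l] {ω | ∀ i ∈ Finset.Icc 1 l,
      lev X i σ ω ∈ Set.Icc (-C) C ∧ lev X i τ ω ∈ Set.Icc (-C) C} := by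
  have : {ω | ∀ i ∈ Finset.Icc 1 l,
      lev X i σ ω ∈ Set.Icc (-C) C ∧ lev X i τ ω ∈ Set.Icc (-C) C} =
      {ω | ∀ i ∈ Finset.Icc 1 l, lev X i σ ω ∈ Set.Icc (-C) C} ∩
      {ω | ∀ i ∈ Finset.Icc 1 l, lev X i τ ω ∈ Set.Icc (-C) C} := by
    ext ω
    simp only [Set.mem_ofPred_eq, Set.mem_inter_iff]
    exact forall₂_and
  rw [this]
  exact (measurableSet_windows l C σ).inter (measurableSet_windows l C τ)

lemma forall_mem_Icc_succ_iff {l : ℕ} {p : ℕ → Prop} :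
    (∀ i ∈ Finset.Icc 1 (l + 1), p i) ↔ (∀ i ∈ Finset.Icc 1 l, p i) ∧ p (l + 1) := by
  constructor
  · intro h
    refine ⟨fun i hi => h i ?_, h _ ?_⟩ <;> simp only [Finset.mem_Icc] at * <;> omega
  · rintro ⟨h1, h2⟩ i hi
    rcases eq_or_ne i (l + 1) with rfl | hne
    · exact h2
    · refine h1 i ?_
      simp only [Finset.mem_Icc] at *
      omega

variable [m : MeasurableSpace Ω] {Pr : Measure Ω} [IsProbabilityMeasure Pr]
variable (hcover : ∀ i : Fin n, ∃ J ∈ M.P Finset.univ, i ∈ J)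
  (hX : M.IsDisorder Pr X) (hm : ∀ J τ, Measurable (X J τ)) (hN : 0 < N)
include hX hm

omit [IsProbabilityMeasure Pr] in
lemma measure_past_inter {l : ℕ} {E F : Set Ω} (hE : MeasurableSet[past X l] E)
    (hF : MeasurableSet[sig X {p : M.Site N | p.1.1 ∈ M.level (l + 1)}] F) :
    Pr (E ∩ F) = Pr E * Pr F :=
  (Indep_iff _ _ _).1 (indep_past hX hm l) E F hE hF

omit m [IsProbabilityMeasure Pr] hX hm in
lemma measurableSet_lev_succ_mem (l : ℕ) (C : ℝ) (σ : M.Full N) :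
    MeasurableSet[sig X {p : M.Site N | p.1.1 ∈ M.level l}]
      {ω | lev X l σ ω ∈ Set.Icc (-C) C} :=
  (Measurable.sub_const (measurable_en (level_subset l) fun _ hp => hp.1) _) measurableSet_Icc

include hcover hN

lemma measure_windows_le {l : ℕ} (hK : l ≤ M.K) {C : ℝ} (hC : 0 ≤ C) (σ : M.Full N) :
    Pr {ω | ∀ i ∈ Finset.Icc 1 l, lev X i σ ω ∈ Set.Icc (-C) C} ≤
      ENNReal.ofReal (∏ i ∈ Finset.Icc 1 l, M.levWeight N i * M.winConst C i) := by
  induction l with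
  | zero => simp
  | succ l ih =>
    simp only [forall_mem_Icc_succ_iff]
    rw [Finset.prod_Icc_succ_top (by omega), ENNReal.ofReal_mul (Finset.prod_nonneg fun i _ =>
      mul_nonneg (levWeight_pos i).le (winConst_nonneg hC i))]
    refine (measure_past_inter hX hm (measurableSet_windows l C σ)
      (measurableSet_lev_succ_mem (l + 1) C σ)).trans_le ?_
    exact mul_le_mul' (ih (by omega)) (measure_lev_le hcover hX hm hN (by omega) hK C σ)

/-- On the levels after `r` the two configurations use disjoint sets of variables, so each such
level pays its weight twice. Up to `r` only the windows of `σ` are kept. -/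
lemma measure_pair_windows_le {r l : ℕ} (hrl : r ≤ l) (hK : l ≤ M.K) {C : ℝ} (hC : 0 ≤ C)
    {σ τ : M.Full N} (h : ∀ q, r < q → q ≤ l → ∀ J ∈ M.level q, ∃ i ∈ J, σ i ≠ τ i) :
    Pr {ω | ∀ i ∈ Finset.Icc 1 l, lev X i σ ω ∈ Set.Icc (-C) C ∧ lev X i τ ω ∈ Set.Icc (-C) C} ≤
      ENNReal.ofReal ((∏ i ∈ Finset.Icc 1 l, M.levWeight N i * M.winConst C i) *
        ∏ i ∈ Finset.Icc (r + 1) l, M.levWeight N i * M.winConst C i) := by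
  have hw : ∀ i, 0 ≤ M.levWeight N i * M.winConst C i := fun i =>
    mul_nonneg (levWeight_pos i).le (winConst_nonneg hC i)
  induction l, hrl using Nat.le_induction with
  | base =>
    rw [Finset.Icc_eq_empty_of_lt (Nat.lt_succ_self r), Finset.prod_empty, mul_one]
    exact (measure_mono fun ω hω i hi => (hω i hi).1).trans
      (measure_windows_le hcover hX hm hN hK hC σ)
  | succ l hl ih =>
    simp only [forall_mem_Icc_succ_iff]
    have hind : IndepFun (lev X (l + 1) σ) (lev X (l + 1) τ) Pr :=
      indepFun_of_disjoint hX hm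
        (disjoint_sites fun J hJ _ => h (l + 1) (by omega) le_rfl J hJ)
        (Measurable.sub_const (measurable_en (level_subset (l + 1)) le_rfl) _)
        (Measurable.sub_const (measurable_en (level_subset (l + 1)) le_rfl) _)
    refine (measure_past_inter hX hm (measurableSet_pair_windows l C σ τ) ((measurableSet_lev_succ_mem (l + 1) C σ).inter
      (measurableSet_lev_succ_mem (l + 1) C τ))).trans_le ?_
    have h2 := hind.measure_inter_preimage_eq_mul (Set.Icc (-C) C) (Set.Icc (-C) C)
      measurableSet_Icc measurableSet_Icc
    refine (mul_le_mul' (ih (by omega) fun q h1 h2 => h q h1 (by omega)) (h2.trans_le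
      (mul_le_mul' (measure_lev_le hcover hX hm hN (by omega) hK C σ)
        (measure_lev_le hcover hX hm hN (by omega) hK C τ)))).trans_eq ?_
    have h3 : 0 ≤ ∏ i ∈ Finset.Icc 1 l, M.levWeight N i * M.winConst C i :=
      Finset.prod_nonneg fun i _ => hw i
    have h4 : 0 ≤ ∏ i ∈ Finset.Icc (r + 1) l, M.levWeight N i * M.winConst C i :=
      Finset.prod_nonneg fun i _ => hw i
    rw [← ENNReal.ofReal_mul (hw _), ← ENNReal.ofReal_mul (mul_nonneg h3 h4),
      Finset.prod_Icc_succ_top (by omega), Finset.prod_Icc_succ_top (by omega)]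
    congr 1
    ring

end windows

end GREM

/-! ### The level of overlap: truncation of the shared energy -/

namespace GREM

variable {n : ℕ} {M : GREM n} {N k r : ℕ} {S : Finset (Fin n)}

/-- The difference of `log 2 · γ(S \ A_{k-1})` and `β_k² / 2` times the shared variance. -/
def kap (M : GREM n) (k : ℕ) (S : Finset (Fin n)) : ℝ :=
  Real.log 2 * M.gam (S \ M.chain (k - 1)) - M.beta k ^ 2 * (∑ J ∈ M.shared k S, M.a J) / 2

/-- The level at which the shared energy is truncated. -/
def cut (M : GREM n) (N k : ℕ) (S : Finset (Fin n)) : ℝ :=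
  M.beta k * (∑ J ∈ M.shared k S, M.a J) * N + M.kap k S * N / M.beta k

/-- The value of `cut` is chosen for this identity. Its inverse turns the tail of the shared energy
into `cap (S \ A_{k-1})⁻¹`, while in the couple bound it costs the factor `cap (S \ A_{k-1})` and no
more. -/
lemma exp_beta_mul_cut (hβ : 0 < M.beta k) :
    Real.exp (M.beta k * M.cut N k S) =
      M.cap N (S \ M.chain (k - 1)) *
        Real.exp (M.beta k ^ 2 * (∑ J ∈ M.shared k S, M.a J) * N / 2) := by
  rw [cap, ← Real.exp_add, cut, kap]
  congr 1
  field_simp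
  ring

variable {Ω : Type*} {X : (J : Finset (Fin n)) → M.Conf N J → Ω → ℝ}
variable [m : MeasurableSpace Ω] {Pr : Measure Ω} [IsProbabilityMeasure Pr]
variable (hcover : ∀ i : Fin n, ∃ J ∈ M.P Finset.univ, i ∈ J)
  (hX : M.IsDisorder Pr X) (hm : ∀ J τ, Measurable (X J τ)) (hN : 0 < N)

/-- The constant in the bound of the probability of a large shared energy. -/
def tailConst (M : GREM n) (k : ℕ) (S : Finset (Fin n)) : ℝ :=
  (√(2 * Real.pi * ∑ J ∈ M.shared k S, M.a J))⁻¹ / M.beta k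

/-- The constant in the bound of the probability of a pair of windows at level `k`. -/
def pairConst (M : GREM n) (C : ℝ) (k : ℕ) (S : Finset (Fin n)) : ℝ :=
  M.tailConst k S * (2 * Real.pi * ∑ J ∈ M.unshared k S, M.a J)⁻¹ *
    (Real.exp (M.beta k * C) * (2 * C) / (M.beta k * √(2 * Real.pi * M.Delta k))) ^ 2

include hX hm hN

lemma measure_shared_ge_le (hβ : 0 < M.beta k) (hd : 0 < ∑ J ∈ M.shared k S, M.a J)
    (σ : M.Full N) :
    Pr {ω | M.cut N k S ≤ en X (M.shared k S) σ ω} ≤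
      ENNReal.ofReal (M.tailConst k S / √N * (M.cap N (S \ M.chain (k - 1)))⁻¹) := by
  have hN' : (0 : ℝ) < N := by exact_mod_cast hN
  have h := map_en_le hX hm (shared_subset.trans (level_subset k)) σ (M.beta k)
    (mul_pos hd hN') (Set.Ici (M.cut N k S))
  rw [Measure.map_apply (measurable_en' hm _ σ) measurableSet_Ici] at h
  refine h.trans_eq ?_
  rw [Measure.smul_apply, smul_eq_mul, expWeight_Ici hβ,
    ← ENNReal.ofReal_mul (gaussConst_nonneg _ _), neg_mul, Real.exp_neg, exp_beta_mul_cut hβ,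
    gaussConst, tailConst, ← mul_assoc (2 * Real.pi), Real.sqrt_mul (by positivity), ← mul_assoc]
  congr 1
  have := cap_pos (M := M) (N := N) (S \ M.chain (k - 1))
  field_simp

include hcover

/-- The power of `N`: the densities of one shared and two unshared parts contribute `N ^ (-3/2)`,
the centering of two windows contributes `N`, and `1 / √N` remains. This needs a nondegenerate
unshared part. -/
lemma measure_level_pair_le (hk : 1 ≤ k) (hK : k ≤ M.K) {C : ℝ} (hC : 0 ≤ C)
    (hd : 0 < ∑ J ∈ M.shared k S, M.a J) (hd' : 0 < ∑ J ∈ M.unshared k S, M.a J)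
    {σ τ : M.Full N} (hστ : ∀ i ∈ M.chain k, σ i = τ i ↔ i ∈ S) :
    Pr {ω | en X (M.shared k S) σ ω ≤ M.cut N k S ∧ lev X k σ ω ∈ Set.Icc (-C) C ∧
        lev X k τ ω ∈ Set.Icc (-C) C} ≤
      ENNReal.ofReal (M.pairConst C k S / √N * M.levWeight N k ^ 2 *
        M.cap N (S \ M.chain (k - 1))) := by
  have hN' : (0 : ℝ) < N := by exact_mod_cast hN
  have hβ := M.beta_pos hcover hk hK
  have hΔ := M.Delta_pos hcover hk hK
  have hsP : M.shared k S ⊆ M.P Finset.univ := shared_subset.trans (level_subset k)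
  have huP : M.unshared k S ⊆ M.P Finset.univ := unshared_subset.trans (level_subset k)
  have hY : en X (M.shared k S) σ = en X (M.shared k S) τ := en_congr fun J hJ i hi => by
    obtain ⟨h1, h2⟩ := Finset.mem_filter.1 hJ
    exact (hστ i (M.subset_of_mem_level h1 hi)).2 (h2 hi)
  have hYZ : IndepFun (en X (M.shared k S) σ)
      (fun ω => (en X (M.unshared k S) σ ω, en X (M.unshared k S) τ ω)) Pr := by
    refine indepFun_of_disjoint hX hm (S := {p : M.Site N | p.1.1 ∈ M.shared k S})
      (T := {p : M.Site N | p.1.1 ∈ M.unshared k S}) ?_ (measurable_en hsP fun p hp => hp.1)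
      ((measurable_en huP fun p hp => hp.1).prodMk (measurable_en huP fun p hp => hp.1))
    rw [Set.disjoint_left]
    exact fun p h1 h2 => Finset.disjoint_left.1 disjoint_shared_unshared h1 h2
  have hZZ : IndepFun (en X (M.unshared k S) σ) (en X (M.unshared k S) τ) Pr := by
    refine indepFun_of_disjoint hX hm (disjoint_sites fun J hJ _ => ?_)
      (measurable_en huP le_rfl) (measurable_en huP le_rfl)
    obtain ⟨h1, h2⟩ := Finset.mem_filter.1 hJ
    obtain ⟨i, hiJ, hiS⟩ := Finset.not_subset.1 h2
    exact ⟨i, hiJ, fun he => hiS ((hστ i (M.subset_of_mem_level h1 hiJ)).1 he)⟩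
  have key := measure_shared_le (measurable_en' hm _ σ) (measurable_en' hm _ σ)
    (measurable_en' hm _ τ) hYZ hZZ hβ (gaussConst_nonneg _ _) (gaussConst_nonneg _ _)
    (map_en_le hX hm hsP σ _ (mul_pos hd hN')) (map_en_le hX hm huP σ _ (mul_pos hd' hN'))
    (map_en_le hX hm huP τ _ (mul_pos hd' hN'))
    (show M.aN N k - C ≤ M.aN N k + C by linarith) (M.cut N k S)
  have hlev : ∀ (υ : M.Full N) ω, lev X k υ ω ∈ Set.Icc (-C) C →
      en X (M.shared k S) υ ω + en X (M.unshared k S) υ ω ∈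
        Set.Icc (M.aN N k - C) (M.aN N k + C) := by
    intro υ ω h
    rw [← en_union disjoint_shared_unshared, shared_union_unshared]
    simp only [lev, Set.mem_Icc] at h ⊢
    constructor <;> linarith [h.1, h.2]
  refine (measure_mono fun ω hω => ?_).trans (key.trans_eq ?_)
  · refine ⟨hω.1, hlev σ ω hω.2.1, ?_⟩
    rw [hY]
    exact hlev τ ω hω.2.2
  · congr 1
    have e1 : Real.exp (-M.beta k * (M.aN N k - C)) =
        Real.exp (M.beta k * C) * Real.exp (-M.beta k * M.aN N k) := by
      rw [← Real.exp_add]; ring_nf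
    rw [e1, exp_neg_beta_aN hβ hΔ hN, exp_beta_mul_cut hβ, pairConst, tailConst, gaussConst,
      gaussConst, levWeight, ← sum_shared_add_sum_unshared (S := S)]
    set d := ∑ J ∈ M.shared k S, M.a J
    set d' := ∑ J ∈ M.unshared k S, M.a J
    set b := M.beta k
    have h1 : √(2 * Real.pi * (d' * N)) ^ 2 = 2 * Real.pi * d' * N := by
      rw [Real.sq_sqrt (by positivity)]; ring
    have h2 : √(2 * Real.pi * (d * N)) = √(2 * Real.pi * d) * √N := by
      rw [← mul_assoc, Real.sqrt_mul (by positivity)]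
    have h3 : √(N : ℝ) ^ 2 = N := Real.sq_sqrt hN'.le
    -- The exponentials on the right come from the gaussian constants of `Y`, `Z`, `Z'`, the two
    -- centerings and the cut, in this order; together they leave the square of the level weight.
    have e2 : Real.exp (-(b ^ 2 * (d + d') * N / 2)) ^ 2 =
        Real.exp (b ^ 2 * (d * N) / 2) * Real.exp (b ^ 2 * (d' * N) / 2) ^ 2 *
        Real.exp (-(b ^ 2 * (d + d') * N)) ^ 2 * Real.exp (b ^ 2 * d * N / 2) := by
      simp only [← Real.exp_nat_mul, ← Real.exp_add]
      congr 1
      push_cast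
      ring
    rw [e2, h2]
    have h4 : 0 < √(N : ℝ) := by positivity
    have h5 : 0 < √(2 * Real.pi * d) := by positivity
    have h6 : 0 < √(2 * Real.pi * (d + d')) := by positivity
    have h7 : (√(2 * Real.pi * (d' * N)))⁻¹ ^ 2 = (2 * Real.pi * d' * N)⁻¹ := by
      rw [inv_pow, h1]
    simp only [mul_pow, div_pow, h7, h3]
    field_simp
    ring

end GREM

/-! ### Expected number of couples with a given overlap -/

namespace GREM

variable {n : ℕ} {M : GREM n} {k r : ℕ} {S : Finset (Fin n)}

/-- The pairs of configurations that agree exactly on `S` among the sites of `A_k`. -/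
abbrev OverlapPair (M : GREM n) (N k : ℕ) (S : Finset (Fin n)) : Type :=
  {p : M.Full N × M.Full N // ∀ i ∈ M.chain k, p.1 i = p.2 i ↔ i ∈ S}

lemma OverlapPair.restrict_eq {N : ℕ} {x y : M.OverlapPair N k S}
    (h : ((M.chain k).restrict x.1.1, (M.chain k \ S).restrict x.1.2) =
      ((M.chain k).restrict y.1.1, (M.chain k \ S).restrict y.1.2)) :
    (M.chain k).restrict x.1.1 = (M.chain k).restrict y.1.1 ∧
      (M.chain k).restrict x.1.2 = (M.chain k).restrict y.1.2 := by
  obtain ⟨h1, h2⟩ := Prod.ext_iff.1 h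
  refine ⟨h1, funext fun i => ?_⟩
  by_cases hi : i.1 ∈ S
  · have h3 := (x.2 i i.2).2 hi
    have h4 := (y.2 i i.2).2 hi
    have h5 := congrFun h1 i
    simp only [Finset.restrict] at h5 ⊢
    rw [← h3, ← h4, h5]
  · exact congrFun h2 ⟨i.1, Finset.mem_sdiff.2 ⟨i.2, hi⟩⟩

section
variable {N : ℕ} {Ω : Type*} {X : (J : Finset (Fin n)) → M.Conf N J → Ω → ℝ}
variable [m : MeasurableSpace Ω] {Pr : Measure Ω} [IsProbabilityMeasure Pr]
variable (hcover : ∀ i : Fin n, ∃ J ∈ M.P Finset.univ, i ∈ J)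
  (hX : M.IsDisorder Pr X) (hm : ∀ J τ, Measurable (X J τ)) (hN : 0 < N)
  (h : M.IsOverlap k r S) (hK : k ≤ M.K) {C : ℝ} (hC : 0 ≤ C)

omit m in
lemma card_pairs_le : (Fintype.card (M.Conf N (M.chain k) × M.Conf N (M.chain k \ S)) : ENNReal) ≤
    ENNReal.ofReal (M.cap N (M.chain k) * M.cap N (M.chain k \ S)) := by
  rw [Fintype.card_prod, Nat.cast_mul, ENNReal.ofReal_mul (cap_pos _).le]
  exact mul_le_mul' (card_Conf_le_ofReal _) (card_Conf_le_ofReal _)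

/-- A set of level `q > r` has a site outside `A_{q-1} ⊇ A_r`, and within `A_{k-1}` the
configurations agree only on `A_r`. -/
lemma IsOverlap.exists_ne {σ τ : M.Full N} (h : M.IsOverlap k r S)
    (hστ : ∀ i ∈ M.chain k, σ i = τ i ↔ i ∈ S) {q : ℕ} (hq : r < q) (hqk : q ≤ k - 1)
    {J : Finset (Fin n)} (hJ : J ∈ M.level q) : ∃ i ∈ J, σ i ≠ τ i := by
  obtain ⟨i, hiJ, hi⟩ := Finset.not_subset.1 (mem_level.1 hJ).2
  refine ⟨i, hiJ, fun he => hi ?_⟩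
  have h1 := M.chain_mono hqk (M.subset_of_mem_level hJ hiJ)
  have h2 : i ∈ S ∩ M.chain (k - 1) :=
    Finset.mem_inter.2 ⟨(hστ i (M.chain_mono (Nat.sub_le k 1) h1)).1 he, h1⟩
  rw [h.inter] at h2
  exact M.chain_mono (by omega) h2

-- Agreement on `A_r` removes choices of `τ` and weights in equal measure. Agreement on `S \
-- A_{k-1}` removes choices only, whence the surplus factor.
include hcover h hK in
lemma IsOverlap.cap_weights :
    M.cap N (M.chain k) * M.cap N (M.chain k \ S) *
      ((∏ i ∈ Finset.Icc 1 k, M.levWeight N i) *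
        ∏ i ∈ Finset.Icc (r + 1) k, M.levWeight N i) * M.cap N (S \ M.chain (k - 1)) = 1 := by
  have h1 := prod_levWeight_mul_cap (N := N) hcover (Nat.zero_le k) hK
  have h2 := prod_levWeight_mul_cap (N := N) hcover h.lt.le hK
  have h3 := h.cap_sdiff N
  rw [cap_chain_zero, zero_add] at h1
  rw [h.cap_overlap] at h3
  have h5 := cap_pos (M := M) (N := N) (M.chain k)
  rw [← h2] at h3
  refine mul_left_cancel₀ h5.ne' ?_
  linear_combination (M.cap N (M.chain k)) * h1 + (∏ i ∈ Finset.Icc 1 k, M.levWeight N i) *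
    M.cap N (M.chain k) * h3

include hcover hX hm hN h hK hC

lemma measure_truncated_le (hd : 0 < ∑ J ∈ M.shared k S, M.a J) :
    Pr {ω | ∃ σ : M.Full N, (∀ i ∈ Finset.Icc 1 r, lev X i σ ω ∈ Set.Icc (-C) C) ∧
      M.cut N k S ≤ en X (M.shared k S) σ ω} ≤
      ENNReal.ofReal ((∏ i ∈ Finset.Icc 1 r, M.winConst C i) * M.tailConst k S / √N) := by
  have hk := h.one_le
  have hr := h.lt
  have hβ := M.beta_pos hcover hk hK
  have hrS : M.chain r ⊆ S := h.inter ▸ Finset.inter_subset_left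
  have key := measure_exists_le_card_mul (Pr := Pr)
    (fun σ : M.Full N => {ω | (∀ i ∈ Finset.Icc 1 r, lev X i σ ω ∈ Set.Icc (-C) C) ∧
      M.cut N k S ≤ en X (M.shared k S) σ ω})
    -- Both the shared energy and the levels up to `r` depend on `σ` only through `S`, as `A_r ⊆ S`.
    -- Counting on `S` instead of `A_k` is what makes the tail bound sufficient.
    (fun σ => S.restrict σ)
    (p := ENNReal.ofReal ((∏ i ∈ Finset.Icc 1 r, M.levWeight N i * M.winConst C i) *
      (M.tailConst k S / √N * (M.cap N (S \ M.chain (k - 1)))⁻¹)))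
    (fun σ τ hστ => by
      have h1 : en X (M.shared k S) σ = en X (M.shared k S) τ := en_congr fun J hJ i hi =>
        congrFun hστ ⟨i, (Finset.mem_filter.1 hJ).2 hi⟩
      have h2 : (M.chain r).restrict σ = (M.chain r).restrict τ :=
        funext fun i => congrFun hστ ⟨i, hrS i.2⟩
      ext ω
      simp only [Set.mem_ofPred_eq]
      rw [h1]
      refine and_congr_left fun _ => forall₂_congr fun i hi => ?_
      rw [lev_congr (Finset.mem_Icc.1 hi).2 h2])
    (fun σ => by
      rw [ENNReal.ofReal_mul (Finset.prod_nonneg fun i _ =>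
        mul_nonneg (levWeight_pos i).le (winConst_nonneg hC i))]
      have hF : MeasurableSet[sig X {p : M.Site N | p.1.1 ∈ M.level (k - 1 + 1)}]
          {ω | M.cut N k S ≤ en X (M.shared k S) σ ω} := by
        rw [Nat.sub_add_cancel hk]
        exact (measurable_en (shared_subset.trans (level_subset k))
          fun p hp => shared_subset hp.1) measurableSet_Ici
      refine (measure_past_inter hX hm (l := k - 1)
        (past_mono (by omega : r ≤ k - 1) _ (measurableSet_windows r C σ)) hF).trans_le ?_
      exact mul_le_mul' (measure_windows_le hcover hX hm hN (by omega) hC σ)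
        (measure_shared_ge_le hX hm hN hβ hd σ))
  refine key.trans ((mul_le_mul_left (card_Conf_le_ofReal _) _).trans ?_)
  rw [← ENNReal.ofReal_mul (cap_pos _).le]
  refine ENNReal.ofReal_le_ofReal (le_of_eq ?_)
  have h1 := prod_levWeight_mul_cap (N := N) hcover (Nat.zero_le r) (by omega)
  rw [cap_chain_zero, zero_add] at h1
  have h2 := cap_pos (M := M) (N := N) (S \ M.chain (k - 1))
  rw [Finset.prod_mul_distrib, h.cap_overlap]
  field_simp
  linear_combination (∏ i ∈ Finset.Icc 1 r, M.winConst C i) * M.tailConst k S * h1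

lemma measure_pairs_below_cut_le (hd : 0 < ∑ J ∈ M.shared k S, M.a J)
    (hd' : 0 < ∑ J ∈ M.unshared k S, M.a J) :
    Pr {ω | ∃ x : M.OverlapPair N k S, (∀ i ∈ Finset.Icc 1 (k - 1),
        lev X i x.1.1 ω ∈ Set.Icc (-C) C ∧ lev X i x.1.2 ω ∈ Set.Icc (-C) C) ∧
        en X (M.shared k S) x.1.1 ω ≤ M.cut N k S ∧ lev X k x.1.1 ω ∈ Set.Icc (-C) C ∧
        lev X k x.1.2 ω ∈ Set.Icc (-C) C} ≤
      ENNReal.ofReal ((∏ i ∈ Finset.Icc 1 (k - 1), M.winConst C i) *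
        (∏ i ∈ Finset.Icc (r + 1) (k - 1), M.winConst C i) * M.pairConst C k S / √N) := by
  have hk := h.one_le
  have hr := h.lt
  have hw : ∀ i, 0 ≤ M.levWeight N i * M.winConst C i := fun i =>
    mul_nonneg (levWeight_pos i).le (winConst_nonneg hC i)
  have key := measure_exists_le_card_mul (Pr := Pr)
    (fun x : M.OverlapPair N k S => {ω | (∀ i ∈ Finset.Icc 1 (k - 1),
        lev X i x.1.1 ω ∈ Set.Icc (-C) C ∧ lev X i x.1.2 ω ∈ Set.Icc (-C) C) ∧
        en X (M.shared k S) x.1.1 ω ≤ M.cut N k S ∧ lev X k x.1.1 ω ∈ Set.Icc (-C) C ∧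
        lev X k x.1.2 ω ∈ Set.Icc (-C) C})
    (fun x => ((M.chain k).restrict x.1.1, (M.chain k \ S).restrict x.1.2))
    (p := ENNReal.ofReal (((∏ i ∈ Finset.Icc 1 (k - 1), M.levWeight N i * M.winConst C i) *
        ∏ i ∈ Finset.Icc (r + 1) (k - 1), M.levWeight N i * M.winConst C i) *
        (M.pairConst C k S / √N * M.levWeight N k ^ 2 * M.cap N (S \ M.chain (k - 1)))))
    (fun x y hxy => by
      obtain ⟨h1, h2⟩ := OverlapPair.restrict_eq hxy
      have h3 : en X (M.shared k S) x.1.1 = en X (M.shared k S) y.1.1 :=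
        en_congr fun J hJ i hi =>
          congrFun h1 ⟨i, M.subset_of_mem_level (Finset.mem_filter.1 hJ).1 hi⟩
      ext ω
      simp only [Set.mem_ofPred_eq]
      rw [h3, lev_congr le_rfl h1, lev_congr le_rfl h2]
      refine and_congr_left fun _ => forall₂_congr fun i hi => ?_
      have hi' : i ≤ k := (Finset.mem_Icc.1 hi).2.trans (Nat.sub_le k 1)
      rw [lev_congr hi' h1, lev_congr hi' h2])
    (fun x => by
      rw [ENNReal.ofReal_mul (mul_nonneg (Finset.prod_nonneg fun i _ => hw i)
        (Finset.prod_nonneg fun i _ => hw i))]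
      have hE : MeasurableSet[past X (k - 1)] {ω | ∀ i ∈ Finset.Icc 1 (k - 1),
          lev X i x.1.1 ω ∈ Set.Icc (-C) C ∧ lev X i x.1.2 ω ∈ Set.Icc (-C) C} :=
        measurableSet_pair_windows (k - 1) C x.1.1 x.1.2
      have hF : MeasurableSet[sig X {p : M.Site N | p.1.1 ∈ M.level (k - 1 + 1)}]
          {ω | en X (M.shared k S) x.1.1 ω ≤ M.cut N k S ∧ lev X k x.1.1 ω ∈ Set.Icc (-C) C ∧
            lev X k x.1.2 ω ∈ Set.Icc (-C) C} := by
        rw [Nat.sub_add_cancel hk]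
        refine MeasurableSet.inter ?_ (MeasurableSet.inter (measurableSet_lev_succ_mem k C x.1.1)
          (measurableSet_lev_succ_mem k C x.1.2))
        exact (measurable_en (shared_subset.trans (level_subset k))
          fun p hp => shared_subset hp.1) measurableSet_Iic
      refine (measure_past_inter hX hm hE hF).trans_le ?_
      exact mul_le_mul' (measure_pair_windows_le hcover hX hm hN (by omega) (by omega) hC
        fun q h1 h2 J hJ => h.exists_ne x.2 h1 h2 hJ)
        (measure_level_pair_le hcover hX hm hN hk hK hC hd hd' x.2))
  refine key.trans ((mul_le_mul_left card_pairs_le _).trans ?_)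
  rw [← ENNReal.ofReal_mul (mul_nonneg (cap_pos _).le (cap_pos _).le)]
  refine ENNReal.ofReal_le_ofReal (le_of_eq ?_)
  have h1 := h.cap_weights hcover (N := N) hK
  have e : ∀ s, s ≤ k - 1 → ∏ i ∈ Finset.Icc (s + 1) k, M.levWeight N i =
      (∏ i ∈ Finset.Icc (s + 1) (k - 1), M.levWeight N i) * M.levWeight N k := by
    intro s hs
    have := Finset.prod_Icc_succ_top (a := s + 1) (b := k - 1) (by omega) (M.levWeight N)
    rwa [Nat.sub_add_cancel hk] at this
  have e0 := e 0 (Nat.zero_le _)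
  rw [zero_add] at e0
  rw [e0, e r (by omega)] at h1
  rw [Finset.prod_mul_distrib, Finset.prod_mul_distrib]
  linear_combination ((∏ i ∈ Finset.Icc 1 (k - 1), M.winConst C i) *
        (∏ i ∈ Finset.Icc (r + 1) (k - 1), M.winConst C i) * M.pairConst C k S / √N) * h1

lemma measure_pairs_of_shared_empty_le (hs : M.shared k S = ∅) :
    Pr {ω | ∃ x : M.OverlapPair N k S, ∀ i ∈ Finset.Icc 1 k,
        lev X i x.1.1 ω ∈ Set.Icc (-C) C ∧ lev X i x.1.2 ω ∈ Set.Icc (-C) C} ≤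
      ENNReal.ofReal ((∏ i ∈ Finset.Icc 1 k, M.winConst C i) *
        (∏ i ∈ Finset.Icc (r + 1) k, M.winConst C i) *
        Real.exp (-(Real.log 2 * M.gam (S \ M.chain (k - 1)) * N))) := by
  have key := measure_exists_le_card_mul (Pr := Pr)
    (fun x : M.OverlapPair N k S => {ω | ∀ i ∈ Finset.Icc 1 k,
        lev X i x.1.1 ω ∈ Set.Icc (-C) C ∧ lev X i x.1.2 ω ∈ Set.Icc (-C) C})
    (fun x => ((M.chain k).restrict x.1.1, (M.chain k \ S).restrict x.1.2))
    (fun x y hxy => by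
      obtain ⟨h1, h2⟩ := OverlapPair.restrict_eq hxy
      ext ω
      refine forall₂_congr fun i hi => ?_
      have hi' : i ≤ k := (Finset.mem_Icc.1 hi).2
      rw [lev_congr hi' h1, lev_congr hi' h2])
    (fun x => measure_pair_windows_le hcover hX hm hN h.lt.le hK hC
      (fun q h1 h2 J hJ => by
        rcases h2.eq_or_lt with rfl | h2
        · have hJS : ¬ J ⊆ S := fun hJS =>
            Finset.notMem_empty J (hs ▸ Finset.mem_filter.2 ⟨hJ, hJS⟩)
          obtain ⟨i, hiJ, hiS⟩ := Finset.not_subset.1 hJS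
          exact ⟨i, hiJ, fun he => hiS ((x.2 i (M.subset_of_mem_level hJ hiJ)).1 he)⟩
        · exact h.exists_ne x.2 h1 (by omega) hJ))
  refine key.trans ((mul_le_mul_left card_pairs_le _).trans ?_)
  rw [← ENNReal.ofReal_mul (mul_nonneg (cap_pos _).le (cap_pos _).le)]
  refine ENNReal.ofReal_le_ofReal (le_of_eq ?_)
  have h1 : _ = Real.exp (-(Real.log 2 * M.gam (S \ M.chain (k - 1)) * N)) :=
    (eq_inv_of_mul_eq_one_left (h.cap_weights hcover (N := N) hK)).trans (Real.exp_neg _).symm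
  rw [Finset.prod_mul_distrib, Finset.prod_mul_distrib, ← h1]
  ring

end

/-- Without shared sets the bound decays exponentially, because `S \ A_{k-1}` is not empty.
Otherwise the shared energy is above or below the cut, and each case gives a constant over `√N`. -/
lemma exists_pair_bound (hcover : ∀ i : Fin n, ∃ J ∈ M.P Finset.univ, i ∈ J) (hirr : M.CondC')
    (h : M.IsOverlap k r S) (hK : k ≤ M.K) {C : ℝ} (hC : 0 ≤ C) :
    ∃ u : ℕ → ℝ, Tendsto u atTop (nhds 0) ∧ ∀ {N : ℕ}, 0 < N → ∀ {Ω : Type*} [MeasurableSpace Ω]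
      {Pr : Measure Ω} [IsProbabilityMeasure Pr]
      {X : (J : Finset (Fin n)) → M.Conf N J → Ω → ℝ},
      M.IsDisorder Pr X → (∀ J τ, Measurable (X J τ)) →
      Pr {ω | ∃ x : M.OverlapPair N k S, ∀ i ∈ Finset.Icc 1 k,
        lev X i x.1.1 ω ∈ Set.Icc (-C) C ∧ lev X i x.1.2 ω ∈ Set.Icc (-C) C} ≤
        ENNReal.ofReal (u N) := by
  have hk := h.one_le
  have hr := h.lt
  rcases (M.shared k S).eq_empty_or_nonempty with hs | hs
  · refine ⟨_, ?_, fun hN _ _ _ _ _ hX hm =>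
      measure_pairs_of_shared_empty_le hcover hX hm hN h hK hC hs⟩
    rw [← mul_zero ((∏ i ∈ Finset.Icc 1 k, M.winConst C i) *
      ∏ i ∈ Finset.Icc (r + 1) k, M.winConst C i)]
    refine Tendsto.const_mul _ (Real.tendsto_exp_neg_atTop_nhds_zero.comp ?_)
    exact tendsto_natCast_atTop_atTop.const_mul_atTop
      (mul_pos log_two_pos (M.gam_pos h.nonempty))
  · have hd := sum_pos_of_nonempty shared_subset hs
    have hd' := sum_pos_of_nonempty unshared_subset (h.unshared_nonempty hcover hirr hK)
    refine ⟨fun N => (∏ i ∈ Finset.Icc 1 r, M.winConst C i) * M.tailConst k S / √N +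
      (∏ i ∈ Finset.Icc 1 (k - 1), M.winConst C i) *
        (∏ i ∈ Finset.Icc (r + 1) (k - 1), M.winConst C i) * M.pairConst C k S / √N, ?_, ?_⟩
    · have hsq : Tendsto (fun N : ℕ => √(N : ℝ)) atTop atTop :=
        Real.tendsto_sqrt_atTop.comp tendsto_natCast_atTop_atTop
      simpa using (hsq.const_div_atTop _).add (hsq.const_div_atTop _)
    · intro N hN Ω _ Pr _ X hX hm
      have hβ := M.beta_nonneg k
      have ht : 0 ≤ M.tailConst k S := div_nonneg (by positivity) hβ
      have hp : 0 ≤ M.pairConst C k S :=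
        mul_nonneg (mul_nonneg ht (by positivity)) (sq_nonneg _)
      have hw : ∀ s : Finset ℕ, 0 ≤ ∏ i ∈ s, M.winConst C i := fun s =>
        Finset.prod_nonneg fun i _ => winConst_nonneg hC i
      rw [ENNReal.ofReal_add
        (div_nonneg (mul_nonneg (hw _) ht) (Real.sqrt_nonneg _))
        (div_nonneg (mul_nonneg (mul_nonneg (hw _) (hw _)) hp) (Real.sqrt_nonneg _))]
      refine le_trans ((measure_mono ?_).trans (measure_union_le _ _))
        (add_le_add (measure_truncated_le hcover hX hm hN h hK hC hd)
          (measure_pairs_below_cut_le hcover hX hm hN h hK hC hd hd'))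
      rintro ω ⟨x, hx⟩
      rcases le_total (M.cut N k S) (en X (M.shared k S) x.1.1 ω) with hc | hc
      · refine Or.inl ⟨x.1.1, fun i hi => (hx i ?_).1, hc⟩
        simp only [Finset.mem_Icc] at hi ⊢
        omega
      · have h1 := hx k (Finset.mem_Icc.2 ⟨hk, le_rfl⟩)
        refine Or.inr ⟨x, fun i hi => hx i ?_, hc, h1.1, h1.2⟩
        simp only [Finset.mem_Icc] at hi ⊢
        omega

end GREM

/-! ### From non-ultrametric couples to overlaps, and measurable versions of the disorder -/

namespace GREM

variable {n : ℕ} {M : GREM n} {N : ℕ}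

lemma exists_overlap {j : ℕ} {σ τ : M.Full N}
    (h : ∃ k, 1 ≤ k ∧ k ≤ j ∧ (∃ s ∈ M.chain k \ M.chain (k - 1), σ s = τ s) ∧
      ∃ i ∈ M.chain k, σ i ≠ τ i) :
    ∃ k r S, k ≤ j ∧ M.IsOverlap k r S ∧ ∀ i ∈ M.chain k, σ i = τ i ↔ i ∈ S := by
  classical
  obtain ⟨hk1, hkj, ⟨s, hs, hsστ⟩, q, hq, hqστ⟩ := Nat.find_spec h
  have hmin : ∀ l < Nat.find h, _ := fun l hl => Nat.find_min h hl
  set k := Nat.find h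
  let p : ℕ → Prop := fun l => ∀ i ∈ M.chain l, σ i = τ i
  have hp0 : p 0 := fun i hi => absurd hi (Finset.notMem_empty i)
  have hr := Nat.findGreatest_le (P := p) (k - 1)
  have hpr : p (Nat.findGreatest p (k - 1)) := Nat.findGreatest_spec (Nat.zero_le _) hp0
  refine ⟨k, Nat.findGreatest p (k - 1), (M.chain k).filter fun i => σ i = τ i, hkj, ⟨by omega,
    Finset.filter_subset _ _, ?_, ⟨s, ?_⟩, fun he => hqστ ?_⟩,
    fun i hi => by simp [hi]⟩
  · ext i
    simp only [Finset.mem_inter, Finset.mem_filter]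
    constructor
    · rintro ⟨⟨-, hi⟩, hik⟩
      by_contra hir
      have hex : ∃ l, i ∈ M.chain l := ⟨k - 1, hik⟩
      have hl := Nat.find_spec hex
      have hlk : Nat.find hex ≤ k - 1 := Nat.find_min' hex hik
      have hlr : Nat.findGreatest p (k - 1) < Nat.find hex := by
        by_contra hle
        exact hir (M.chain_mono (not_lt.1 hle) hl)
      -- If `i ∈ A_{k-1} \ A_r` were a site of agreement, the first level containing `i` would be
      -- larger than `r`. By minimality of `k` it is no violation, so the configurations agree on
      -- all of that level, against the maximality of `r`.
      refine Nat.findGreatest_is_greatest hlr hlk fun i' hi' => ?_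
      by_contra hne
      refine hmin (Nat.find hex) (by omega) ⟨by omega, by omega, ⟨i, ?_, hi⟩, i', hi', hne⟩
      exact Finset.mem_sdiff.2 ⟨hl, Nat.find_min hex (by omega)⟩
    · exact fun hi => ⟨⟨M.chain_mono (by omega) hi, hpr i hi⟩, M.chain_mono hr hi⟩
  · obtain ⟨h1, h2⟩ := Finset.mem_sdiff.1 hs
    exact Finset.mem_sdiff.2 ⟨Finset.mem_filter.2 ⟨h1, hsστ⟩, h2⟩
  · rw [← he] at hq
    exact (Finset.mem_filter.1 hq).2

lemma size_pos (i : Fin n) : 0 < M.size N i := by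
  refine Nat.floor_pos.2 (Real.one_le_rpow one_le_two ?_)
  have := M.γ_pos i
  positivity

/-- Every site has at least one state, so events about configurations on `A_j` can be studied
through full configurations. -/
lemma exists_restrict_eq {A : Finset (Fin n)} (σ : M.Conf N A) :
    ∃ σ' : M.Full N, A.restrict σ' = σ := by
  classical
  refine ⟨fun i => if h : i ∈ A then σ ⟨i, h⟩ else ⟨0, size_pos i⟩, funext fun i => ?_⟩
  simp [Finset.restrict, i.2]

section
variable {Ω : Type*} {X : (J : Finset (Fin n)) → M.Conf N J → Ω → ℝ}

lemma energyHat_restrict (j : ℕ) (σ : M.Full N) (ω : Ω) :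
    M.energyHat X j ((M.chain j).restrict σ) ω = part X j σ ω := by
  refine Eq.trans ?_ (Finset.sum_coe_sort (Finset.Icc 1 j) fun l => lev X l σ ω)
  refine Finset.sum_congr rfl fun l _ => ?_
  refine congrArg (· - M.aN N l) ?_
  exact Finset.sum_coe_sort (M.level l) fun J => X J (J.restrict σ) ω

lemma part_congr_disorder {X' : (J : Finset (Fin n)) → M.Conf N J → Ω → ℝ} {ω : Ω}
    (h : ∀ J ∈ M.P Finset.univ, ∀ τ, X J τ ω = X' J τ ω) (j : ℕ) (σ : M.Full N) :
    part X j σ ω = part X' j σ ω :=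
  Finset.sum_congr rfl fun l _ => congrArg (· - M.aN N l)
    (Finset.sum_congr rfl fun J hJ => h J (level_subset l hJ) _)

/-- `HasLaw` gives measurability only almost everywhere, whereas the generated σ-algebras have to be
contained in the ambient one. Variables with `J ∉ 𝒫` are unconstrained and are replaced by 0. -/
lemma IsDisorder.exists_measurable [MeasurableSpace Ω] {Pr : Measure Ω}
    (hX : M.IsDisorder Pr X) : ∃ X' : (J : Finset (Fin n)) → M.Conf N J → Ω → ℝ,
      M.IsDisorder Pr X' ∧ (∀ J τ, Measurable (X' J τ)) ∧
      ∀ᵐ ω ∂Pr, ∀ J ∈ M.P Finset.univ, ∀ τ, X J τ ω = X' J τ ω := by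
  have h : ∀ J τ, ∃ g : Ω → ℝ, Measurable g ∧ (J ∈ M.P Finset.univ → X J τ =ᵐ[Pr] g) := by
    intro J τ
    by_cases hJ : J ∈ M.P Finset.univ
    · have := (hX.hasLaw J hJ τ).aemeasurable
      exact ⟨_, this.measurable_mk, fun _ => this.ae_eq_mk⟩
    · exact ⟨fun _ => 0, measurable_const, fun h => absurd h hJ⟩
  choose X' hm hae using h
  refine ⟨X', ⟨fun J hJ τ => (hX.hasLaw J hJ τ).congr (hae J τ hJ).symm, ?_⟩, hm, ?_⟩
  · have key := iIndepFun_congr (μ := Pr) (mβ := fun _ => inferInstance)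
      (f := fun p : M.Site N => X p.1.1 p.2) (g := fun p : M.Site N => X' p.1.1 p.2)
      fun p => hae p.1.1 p.2 p.1.2
    exact key.1 hX.indep
  · simp only [ae_all_iff]
    exact fun J hJ τ => hae J τ hJ

end

end GREM

end

/-! ### Conclusion: union bound over the finitely many overlap types -/

theorem mainTheorem5 {n : ℕ} (M : GREM n)
    (hcover : ∀ i : Fin n, ∃ J ∈ M.P Finset.univ, i ∈ J)
    (hirr : M.Irreducible)
    (j : ℕ) (hj1 : 1 ≤ j) (hjK : j ≤ M.K)
    (D : Set ℝ) (hD : IsCompact D) (ε : ℝ) (hε : 0 < ε) :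
    ∃ N₀ : ℕ, ∀ N ≥ N₀,
      ∀ (Ω : Type*) [MeasurableSpace Ω] (Pr : Measure Ω) [IsProbabilityMeasure Pr]
        (X : (J : Finset (Fin n)) → M.Conf N J → Ω → ℝ), M.IsDisorder Pr X →
        Pr {ω | ∃ σ τ : M.Conf N (M.chain j), M.Nonultrametric j σ τ ∧
          M.energyHat X j σ ω ∈ D ∧ M.energyHat X j τ ω ∈ D} ≤ ENNReal.ofReal ε := by
  obtain ⟨R', hR'⟩ := hD.isBounded.exists_norm_le
  set R := max R' 0
  have hDR : ∀ x ∈ D, x ∈ Set.Icc (-R) R := fun x hx =>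
    abs_le.1 ((hR' x hx).trans (le_max_left _ _))
  obtain ⟨C, hC, htight⟩ :=
    GREM.exists_window hcover hj1 hjK (le_max_right R' 0) (half_pos hε)
  have hpair : ∀ t : ℕ × ℕ × Finset (Fin n), ∃ u : ℕ → ℝ, Tendsto u atTop (nhds 0) ∧
      (t.1 ≤ j → M.IsOverlap t.1 t.2.1 t.2.2 → ∀ {N : ℕ}, 0 < N → ∀ {Ω : Type _}
        [MeasurableSpace Ω] {Pr : Measure Ω} [IsProbabilityMeasure Pr]
        {X : (J : Finset (Fin n)) → M.Conf N J → Ω → ℝ},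
        M.IsDisorder Pr X → (∀ J τ, Measurable (X J τ)) →
        Pr {ω | ∃ x : M.OverlapPair N t.1 t.2.2, ∀ i ∈ Finset.Icc 1 t.1,
          GREM.lev X i x.1.1 ω ∈ Set.Icc (-C) C ∧ GREM.lev X i x.1.2 ω ∈ Set.Icc (-C) C} ≤
          ENNReal.ofReal (u N)) := by
    intro t
    by_cases ht : t.1 ≤ j ∧ M.IsOverlap t.1 t.2.1 t.2.2
    · obtain ⟨u, hu, hb⟩ :=
        GREM.exists_pair_bound hcover hirr.2 ht.2 (ht.1.trans hjK) hC
      exact ⟨u, hu, fun _ _ => hb⟩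
    -- For a triple that is not an overlap type the event is empty, so the zero sequence serves.
    · exact ⟨0, tendsto_const_nhds, fun h1 h2 => absurd ⟨h1, h2⟩ ht⟩
  choose u hu hub using hpair
  -- Since `r < k ≤ j`, this finite set contains every triple that occurs; it does not depend on
  -- `N`.
  let I : Finset (ℕ × ℕ × Finset (Fin n)) :=
    Finset.range (j + 1) ×ˢ Finset.range (j + 1) ×ˢ Finset.univ
  have hlim : Tendsto (fun N => ∑ t ∈ I, |u t N|) atTop (nhds 0) := by
    rw [← Finset.sum_const_zero (s := I)]
    exact tendsto_finsetSum _ fun t _ => by simpa using (hu t).abs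
  obtain ⟨N₀, hN₀⟩ := eventually_atTop.1 (hlim.eventually_lt_const (half_pos hε))
  -- The gaussian bounds require positive variances, hence `N > 0`.
  refine ⟨max N₀ 1, fun N hN Ω _ Pr _ X₀ hX₀ => ?_⟩
  have hN1 : 0 < N := (le_max_right N₀ 1).trans hN
  obtain ⟨X, hX, hm, hae⟩ := hX₀.exists_measurable
  let B : Set Ω := {ω | ∃ σ : M.Full N, GREM.part X j σ ω ∈ Set.Icc (-R) R ∧
    ∃ l ∈ Finset.Icc 1 j, GREM.lev X l σ ω ∉ Set.Icc (-C) C}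
  let F : ℕ × ℕ × Finset (Fin n) → Set Ω := fun t =>
    {ω | M.IsOverlap t.1 t.2.1 t.2.2 ∧ ∃ x : M.OverlapPair N t.1 t.2.2, ∀ i ∈ Finset.Icc 1 t.1,
      GREM.lev X i x.1.1 ω ∈ Set.Icc (-C) C ∧ GREM.lev X i x.1.2 ω ∈ Set.Icc (-C) C}
  have hsub : {ω | ∃ σ τ : M.Conf N (M.chain j), M.Nonultrametric j σ τ ∧
      M.energyHat X₀ j σ ω ∈ D ∧ M.energyHat X₀ j τ ω ∈ D} ≤ᵐ[Pr]
      (B ∪ ⋃ t ∈ I, F t : Set Ω) := by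
    filter_upwards [hae] with ω hω hmem
    obtain ⟨σ₀, τ₀, hna, hσD, hτD⟩ := hmem
    obtain ⟨σ, rfl⟩ := GREM.exists_restrict_eq σ₀
    obtain ⟨τ, rfl⟩ := GREM.exists_restrict_eq τ₀
    rw [GREM.energyHat_restrict, GREM.part_congr_disorder hω] at hσD hτD
    by_cases hB : ω ∈ B
    · exact Or.inl hB
    refine Or.inr ?_
    have hwin : ∀ υ : M.Full N, GREM.part X j υ ω ∈ D → ∀ l ∈ Finset.Icc 1 j,
        GREM.lev X l υ ω ∈ Set.Icc (-C) C := by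
      intro υ hυ l hl
      by_contra hlev
      exact hB ⟨υ, hDR _ hυ, l, hl, hlev⟩
    obtain ⟨k, hk1, hkj, ⟨s, hs, hsστ⟩, q, hq, hqστ⟩ := hna
    obtain ⟨k, r, S, hkj, hov, hστ⟩ := GREM.exists_overlap (σ := σ) (τ := τ)
      ⟨k, hk1, hkj, ⟨s.1, hs, hsστ⟩, q.1, hq, hqστ⟩
    have hlt := hov.lt
    refine Set.mem_biUnion (x := (k, r, S)) ?_ ⟨hov, ⟨(σ, τ), hστ⟩, fun i hi => ?_⟩
    · simp only [I, Finset.coe_product, Finset.coe_range, Finset.coe_univ, Set.mem_prod,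
        Set.mem_Iio, Set.mem_univ, and_true]
      omega
    · have hi' : i ∈ Finset.Icc 1 j := by
        simp only [Finset.mem_Icc] at hi ⊢
        omega
      exact ⟨hwin σ hσD i hi', hwin τ hτD i hi'⟩
  refine (measure_mono_ae hsub).trans ((measure_union_le _ _).trans ?_)
  rw [← add_halves ε, ENNReal.ofReal_add (half_pos hε).le (half_pos hε).le]
  refine add_le_add (htight hN1 hX hm) ((measure_biUnion_finset_le _ _).trans ?_)
  refine le_trans ?_ (ENNReal.ofReal_le_ofReal (hN₀ N ((le_max_left N₀ 1).trans hN)).le)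
  rw [ENNReal.ofReal_sum_of_nonneg fun t _ => abs_nonneg _]
  refine Finset.sum_le_sum fun t ht => ?_
  by_cases hov : M.IsOverlap t.1 t.2.1 t.2.2
  · have htj : t.1 ≤ j := by
      have := (Finset.mem_product.1 ht).1
      rw [Finset.mem_range] at this
      omega
    exact (measure_mono fun ω hω => hω.2).trans ((hub t htj hov hN1 hX hm).trans
      (ENNReal.ofReal_le_ofReal (le_abs_self _)))
  · have : F t = ∅ := Set.eq_empty_of_forall_notMem fun ω hω => hov hω.1
    simp [this]
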